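/- Let $M$ be an $n$-dimensional semisimple Frobenius manifold, $n\ge 1$, given by a simply connected domain in $\mathbb C^n$ (for example a ball) with flat coordinates $v^1,\dots,v^n$, $e=\partial/\partial v^1$: a constant symmetric nondegenerate metric $(\eta_{\alpha\beta})$ with inverse $(\eta^{\alpha\beta})$, a holomorphic potential $F(v)$ with $\partial_1\partial_\alpha\partial_\beta F=\eta_{\alpha\beta}$ satisfying the associativity equations, so that $c^\gamma_{\alpha\beta}=\eta^{\gamma\varepsilon}\partial_\varepsilon\partial_\alpha\partial_\beta F$ are the structure constants of an algebra on $T_vM$, semisimple for generic $v$, and a linear (i.e. affine in $v$) Euler vector field $E$ with $[e,E]=e$ and $\partial_EF=(3-d)F+\text{quadratic}$ for a constant $d$. Put $\mathcal V=\frac{2-d}{2}-\nabla E$, let $\mathcal U(v)$ be the operator of multiplication by $E(v)$ on $T_vM$, and denote by $A^*$ the adjoint of a matrix $A$ with respect to $\eta$. Let $\theta_\alpha(v;z)=\sum_{p\ge 0}\theta_{\alpha,p}(v)z^p$, $\alpha=1,\dots,n$, be the series of a Levelt system of deformed flat coordinates $(\theta_1,\dots,\theta_n)z^{\hat\mu}z^R$.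 That is, $\mathcal V=\hat\mu+R_0$ with $\hat\mu$ semisimple and $R_0$ nilpotent, $R=R_0+R_1+\cdots$ with $[\hat\mu,R_k]=kR_k$ and $R_k^*=(-1)^{k+1}R_k$; the functions $\theta_{\alpha,p}$ are holomorphic on $M$ with $$\theta_{\alpha,0}=\eta_{\alpha\varepsilon}v^\varepsilon,\qquad \partial_\lambda\partial_\mu\theta_{\alpha,p+1}=c^\nu_{\lambda\mu}\,\partial_\nu\theta_{\alpha,p}\quad(p\ge 0),$$ and the matrices $\Theta_p=(\eta^{\alpha\varepsilon}\partial_\varepsilon\theta_{\beta,p})$ satisfy $$(p+1)\Theta_{p+1}+[\Theta_{p+1},\mathcal V]=\mathcal U\,\Theta_p-\sum_{k\ge 1}\Theta_{p-k+1}R_k\quad(p\ge 0),$$ where $\Theta_q=0$ for $q<0$, and $\sum_{k=0}^{p}(-1)^k\Theta_k^*\Theta_{p-k}=0$ for $p\ge 1$. Let $h=h(v;v_x,\dots,v^{(m)})$ be a differential polynomial, i.e. a polynomial in the jet variables $v^{\alpha,s}=\partial_x^s v^\alpha$, $s\ge 1$, with coefficients holomorphic on $M$. Assume that $I=\int h\,dx$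 is a conservation law of the Principal Hierarchy, i.e. for all $\alpha$ and all $p\ge 0$ $$\{I,\bar\theta_{\alpha,p}\}_1=\int \frac{\delta I}{\delta v^\beta(x)}\,\eta^{\beta\gamma}\,\partial_x\frac{\delta\bar\theta_{\alpha,p}}{\delta v^\gamma(x)}\,dx=0,\qquad \bar\theta_{\alpha,p}=\int\theta_{\alpha,p}(v)\,dx,$$ where a local functional $\int f\,dx$ is zero if $f$ is the total $x$-derivative of a differential polynomial plus a constant. Assume also that $h$ is polynomial in $v^1$, i.e. a finite sum $\sum_k (v^1)^k h_k$ with differential polynomials $h_k$ such that $\partial h_k/\partial v^1=0$. Then $$h=\sum_{\alpha,p}c^{\alpha,p}\,\theta_{\alpha,p}(v)+\partial_x g+\mathrm{const}$$ for some differential polynomial $g$ and some constants $c^{\alpha,p}$, only finitely many of which are nonzero. -/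

import Mathlib

open scoped ContDiff

noncomputable section

namespace PrincipalHierarchy

open TopologicalSpace (Opens)

/-! ### Holomorphic functions on a domain in the space of flat coordinates -/

/-- A function on the open set `U ⊆ ℂⁿ` is holomorphic if it is complex-smooth. The extension by
zero is only used to speak of derivatives; on the open set `U` they do not depend on it. -/
def IsHol {n : ℕ} (U : Opens (Fin n → ℂ)) (f : U → ℂ) : Prop :=
  ContDiffOn ℂ ∞ (Function.extend Subtype.val f 0) (U : Set (Fin n → ℂ))

theorem extend_coe {n : ℕ} {U : Opens (Fin n → ℂ)} (f : U → ℂ) {x : Fin n → ℂ} (hx : x ∈ U) :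
    Function.extend Subtype.val f 0 x = f ⟨x, hx⟩ :=
  Subtype.val_injective.extend_apply f 0 ⟨x, hx⟩

/-- A restriction to `U` of a function that is complex-smooth on `U` is holomorphic. -/
theorem IsHol.of_contDiffOn {n : ℕ} {U : Opens (Fin n → ℂ)} {f : U → ℂ} (g : (Fin n → ℂ) → ℂ)
    (hg : ContDiffOn ℂ ∞ g U) (hfg : ∀ x : U, f x = g x) : IsHol U f :=
  hg.congr fun x hx => by rw [extend_coe f hx, hfg ⟨x, hx⟩]

/-- The algebra `𝒪(U)` of holomorphic functions on `U`. -/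
def Hol {n : ℕ} (U : Opens (Fin n → ℂ)) : Subalgebra ℂ (U → ℂ) where
  carrier := {f | IsHol U f}
  mul_mem' {f g} hf hg := IsHol.of_contDiffOn
    (fun x => Function.extend Subtype.val f 0 x * Function.extend Subtype.val g 0 x)
    (ContDiffOn.mul hf hg) fun x => by simp
  add_mem' {f g} hf hg := IsHol.of_contDiffOn
    (fun x => Function.extend Subtype.val f 0 x + Function.extend Subtype.val g 0 x)
    (ContDiffOn.add hf hg) fun x => by simp
  algebraMap_mem' a := IsHol.of_contDiffOn (fun _ => a) contDiffOn_const fun _ => rfl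

/-- The partial derivative `∂f/∂v^α` of a function on `U`, at the points of `U`. -/
def partialFun {n : ℕ} {U : Opens (Fin n → ℂ)} (α : Fin n) (f : U → ℂ) : U → ℂ :=
  fun x => fderiv ℂ (Function.extend Subtype.val f 0) x (Pi.single α 1)

theorem partialFun_isHol {n : ℕ} {U : Opens (Fin n → ℂ)} (α : Fin n) (f : U → ℂ)
    (hf : IsHol U f) : IsHol U (partialFun α f) :=
  IsHol.of_contDiffOn
    (fun x => fderiv ℂ (Function.extend Subtype.val f 0) x (Pi.single α 1))
    ((hf.fderiv_of_isOpen (m := ∞) U.isOpen (by simp)).clm_apply contDiffOn_const) fun _ => rfl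

/-- The partial derivative `∂_α = ∂/∂v^α : 𝒪(U) → 𝒪(U)`. -/
def pd {n : ℕ} {U : Opens (Fin n → ℂ)} (α : Fin n) (f : Hol U) : Hol U :=
  ⟨partialFun α f.1, partialFun_isHol α f.1 f.2⟩

/-- The coordinate function `v^α` on `U`. -/
def coord {n : ℕ} {U : Opens (Fin n → ℂ)} (α : Fin n) : Hol U :=
  ⟨fun x => x.1 α, IsHol.of_contDiffOn (fun x => x α) (contDiff_apply ℂ ℂ α).contDiffOn
    fun _ => rfl⟩

/-- A constant matrix as a matrix of functions on `U`. -/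
def constMatrix {n : ℕ} (U : Opens (Fin n → ℂ)) (A : Matrix (Fin n) (Fin n) ℂ) :
    Matrix (Fin n) (Fin n) (Hol U) :=
  A.map (algebraMap ℂ (Hol U))

/-! ### Frobenius manifolds in flat coordinates -/

/-- An `n`-dimensional Frobenius manifold structure on a domain `U ⊆ ℂⁿ` of flat coordinates
`v^1, …, v^n` (indexed by `Fin n`; the coordinate called `v^1` has index `0`): a nondegenerate
constant metric `η`, a potential `F` solving the associativity equations with constant unity field
`e = ∂/∂v^1`, and a linear Euler vector field `E^α(v) = Q^α_β v^β + r^α` such that `[e, E] = e` and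
`∂_E F = (3 - d) F + quadratic`. -/
structure FrobeniusManifold (n : ℕ) [NeZero n] (U : Opens (Fin n → ℂ)) where
  /-- the matrix `η_{αβ} = ⟨∂_α, ∂_β⟩` -/
  η : Matrix (Fin n) (Fin n) ℂ
  η_symm : η.IsSymm
  η_nondeg : IsUnit η.det
  /-- the potential -/
  F : Hol U
  unity : ∀ α β, pd 0 (pd α (pd β F)) = algebraMap ℂ (Hol U) (η α β)
  assoc : ∀ α β γ δ,
    ∑ l, ∑ m, η⁻¹ l m • (pd α (pd β (pd l F)) * pd m (pd γ (pd δ F))) =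
      ∑ l, ∑ m, η⁻¹ l m • (pd δ (pd β (pd l F)) * pd m (pd γ (pd α F)))
  /-- the linear part of the Euler vector field, that is, the matrix of `∇E` -/
  Q : Matrix (Fin n) (Fin n) ℂ
  /-- the constant part of the Euler vector field -/
  r : Fin n → ℂ
  /-- the charge -/
  d : ℂ
  /-- `[e, E] = e` -/
  euler_unity : ∀ α, Q α 0 = if α = 0 then 1 else 0
  /-- `∂_E F = (3 - d) F + quadratic` -/
  euler_potential : ∃ (A : Matrix (Fin n) (Fin n) ℂ) (b : Fin n → ℂ) (k : ℂ),
    ∑ α, (∑ β, Q α β • coord β + algebraMap ℂ (Hol U) (r α)) * pd α F =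
      (3 - d) • F + (∑ α, ∑ β, A α β • (coord α * coord β) + ∑ α, b α • coord α
        + algebraMap ℂ (Hol U) k)

namespace FrobeniusManifold

variable {n : ℕ} [NeZero n] {U : Opens (Fin n → ℂ)} (M : FrobeniusManifold n U)

/-- The components `E^α` of the Euler vector field. -/
def euler (α : Fin n) : Hol U :=
  ∑ β, M.Q α β • coord β + algebraMap ℂ (Hol U) (M.r α)

/-- The structure functions `c^γ_{αβ}(v) = η^{γε} ∂_ε ∂_α ∂_β F(v)`. -/
def c (γ α β : Fin n) : Hol U :=
  ∑ ε, M.η⁻¹ γ ε • pd ε (pd α (pd β M.F))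

/-- The product `a · b` of the algebra `T_vM`, in components. -/
def mul (v : U) (a b : Fin n → ℂ) : Fin n → ℂ :=
  fun γ => ∑ α, ∑ β, (M.c γ α β).1 v * a α * b β

/-- The algebra `T_vM` is semisimple: it has a basis of pairwise orthogonal idempotents. -/
def IsSemisimpleAt (v : U) : Prop :=
  ∃ π : Module.Basis (Fin n) ℂ (Fin n → ℂ),
    ∀ i j, M.mul v (π i) (π j) = if i = j then π i else 0

/-- `M` is semisimple: the algebras `T_vM` are semisimple for generic `v`. -/
def IsSemisimple : Prop :=
  Dense {v : U | M.IsSemisimpleAt v}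

/-- The matrix `𝒰^α_β = E^ε c^α_{εβ}` of multiplication by the Euler vector field. -/
def eulerMul : Matrix (Fin n) (Fin n) (Hol U) :=
  Matrix.of fun α β => ∑ ε, M.euler ε * M.c α ε β

/-- The matrix `𝒱 = (2 - d)/2 - ∇E`. -/
def calV : Matrix (Fin n) (Fin n) ℂ :=
  ((2 - M.d) / 2) • (1 : Matrix (Fin n) (Fin n) ℂ) - M.Q

/-- The adjoint `A^* = η⁻¹ Aᵀ η` of a constant matrix with respect to the metric. -/
def adj (A : Matrix (Fin n) (Fin n) ℂ) : Matrix (Fin n) (Fin n) ℂ :=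
  M.η⁻¹ * A.transpose * M.η

/-- The adjoint with respect to the metric of a matrix of functions. -/
def adjHol (A : Matrix (Fin n) (Fin n) (Hol U)) : Matrix (Fin n) (Fin n) (Hol U) :=
  constMatrix U M.η⁻¹ * A.transpose * constMatrix U M.η

/-- The matrix `Θ^α_β = η^{αε} ∂_ε θ_β` whose columns are the gradients of the functions `θ_β`. -/
def gradMatrix (θ : Fin n → Hol U) : Matrix (Fin n) (Fin n) (Hol U) :=
  Matrix.of fun α β => ∑ ε, M.η⁻¹ α ε • pd ε (θ β)

end FrobeniusManifold

/-- A choice of Levelt system of deformed flat coordinates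
`(θ_1(v; z), …, θ_n(v; z)) z^μ z^R` of the Frobenius manifold at `z = 0`, where
`θ_α(v; z) = ∑ₚ θ_{α,p}(v) z^p`: the monodromy data `μ`, `R = R_0 + R_1 + …` and the coefficients
`θ_{α,p}`. With `Θ(v; z) = ∑ₚ Θ_p(v) z^p` the matrix of gradients, the last conditions are the
expansions in `z` of `∂_α Y = z C_α Y`, of `∂_z Y = (𝒰 + 𝒱 / z) Y` for `Y = Θ z^μ z^R`, and of
`Θ^*(v; -z) Θ(v; z) = 1`. -/
structure LeveltSystem {n : ℕ} [NeZero n] {U : Opens (Fin n → ℂ)}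
    (M : FrobeniusManifold n U) where
  /-- the semisimple part of `𝒱` -/
  μ : Matrix (Fin n) (Fin n) ℂ
  /-- the components `R_0, R_1, …` of `R`, where `R_0` is the nilpotent part of `𝒱` -/
  R : ℕ → Matrix (Fin n) (Fin n) ℂ
  μ_semisimple : Module.End.IsSemisimple (Matrix.toLin' μ)
  R_zero_nilpotent : IsNilpotent (R 0)
  calV_eq : M.calV = μ + R 0
  R_grading : ∀ k, μ * R k - R k * μ = (k : ℂ) • R k
  R_adj : ∀ k, M.adj (R k) = (-1 : ℂ) ^ (k + 1) • R k
  /-- the functions `θ_{α,p}` -/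
  θ : Fin n → ℕ → Hol U
  /-- `θ_{α,0} = v_α = η_{αε} v^ε` -/
  θ_zero : ∀ α, θ α 0 = ∑ ε, M.η α ε • coord ε
  /-- `∂_λ ∂_μ θ_{α,p+1} = c^ν_{λμ} ∂_ν θ_{α,p}` -/
  θ_succ : ∀ α p l m, pd l (pd m (θ α (p + 1))) = ∑ ν, M.c ν l m * pd ν (θ α p)
  /-- `(p+1) Θ_{p+1} + [Θ_{p+1}, 𝒱] = 𝒰 Θ_p - ∑_{k ≥ 1} Θ_{p-k+1} R_k` -/
  Θ_succ : ∀ p : ℕ,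
    ((p : ℂ) + 1) • M.gradMatrix (fun α => θ α (p + 1))
      + (M.gradMatrix (fun α => θ α (p + 1)) * constMatrix U M.calV
        - constMatrix U M.calV * M.gradMatrix (fun α => θ α (p + 1))) =
    M.eulerMul * M.gradMatrix (fun α => θ α p)
      - ∑ k ∈ Finset.Icc 1 (p + 1),
          M.gradMatrix (fun α => θ α (p + 1 - k)) * constMatrix U (R k)
  /-- `Θ^*(v; -z) Θ(v; z) = 1`; the constant term of this identity is automatic -/
  Θ_orthogonal : ∀ p : ℕ,
    ∑ k ∈ Finset.range (p + 2),
      (-1 : ℂ) ^ k • (M.adjHol (M.gradMatrix fun α => θ α k)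
        * M.gradMatrix fun α => θ α (p + 1 - k)) = 0

/-! ### Differential polynomials and local functionals -/

/-- The ring `𝒜` of differential polynomials `h(v; v_x, v_xx, …)` on `U`: polynomials in the jet
variables `v^{α,s}`, `s ≥ 1`, with coefficients in `𝒪(U)`. The variable `X (α, s)` stands for
`v^{α,s+1}`. -/
abbrev DiffPoly {n : ℕ} (U : Opens (Fin n → ℂ)) : Type :=
  MvPolynomial (Fin n × ℕ) (Hol U)

section DiffPoly

variable {n : ℕ} {U : Opens (Fin n → ℂ)}

/-- A function on `U` as a differential polynomial. -/
def ofFun (f : Hol U) : DiffPoly U := MvPolynomial.C f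

/-- A constant as a differential polynomial. -/
def ofConst (k : ℂ) : DiffPoly U := ofFun (algebraMap ℂ (Hol U) k)

/-- The partial derivative `∂/∂v^α` of differential polynomials, acting on the coefficients. -/
def coeffPd (α : Fin n) (f : DiffPoly U) : DiffPoly U :=
  ∑ m ∈ f.support, MvPolynomial.monomial m (pd α (f.coeff m))

/-- The partial derivative `∂/∂v^{α,s}`, where `v^{α,0} = v^α`. -/
def jetPd (α : Fin n) : ℕ → DiffPoly U → DiffPoly U
  | 0, f => coeffPd α f
  | s + 1, f => MvPolynomial.pderiv (α, s) f

/-- The total derivative `∂_x f = ∑_{α, s ≥ 0} v^{α,s+1} ∂f/∂v^{α,s}`. -/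
def totalDeriv (f : DiffPoly U) : DiffPoly U :=
  ∑ α, MvPolynomial.X (α, 0) * jetPd α 0 f
    + ∑ j ∈ f.vars, MvPolynomial.X (j.1, j.2 + 1) * jetPd j.1 (j.2 + 1) f

/-- The largest `s` such that `v^{α,s}` occurs in `f` for some `α`, or `0` if there is none. -/
def jetOrder (f : DiffPoly U) : ℕ :=
  f.vars.sup fun j => j.2 + 1

/-- The variational derivative `δf̄/δv^α(x) = ∑ₛ (-1)^s ∂_x^s (∂f/∂v^{α,s})` of `f̄ = ∫ f dx`; the
terms with `s > jetOrder f` vanish. -/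
def varDeriv (α : Fin n) (f : DiffPoly U) : DiffPoly U :=
  ∑ s ∈ Finset.range (jetOrder f + 1), (-1) ^ s * totalDeriv^[s] (jetPd α s f)

/-- The density `f` defines the zero local functional `∫ f dx`: it is a total derivative of a
differential polynomial plus a constant (densities are considered modulo constants). -/
def IsZeroFunctional (f : DiffPoly U) : Prop :=
  ∃ (g : DiffPoly U) (k : ℂ), f = totalDeriv g + ofConst k

/-- `h` is polynomial in `v^1`: it is a finite sum of terms `(v^1)^k h_k` with differential
polynomials `h_k` that do not depend on `v^1` (they may depend on `v^1_x, v^1_xx, …`). -/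
def IsPolynomialInFirst [NeZero n] (h : DiffPoly U) : Prop :=
  ∃ (N : ℕ) (a : ℕ → DiffPoly U), (∀ k, coeffPd 0 (a k) = 0) ∧
    h = ∑ k ∈ Finset.range N, ofFun (coord 0) ^ k * a k

end DiffPoly

/-- The density `(δf̄/δv^α) η^{αβ} ∂_x (δḡ/δv^β)` of the first Poisson bracket `{f̄, ḡ}_1`, where
`{v^α(x), v^β(y)}_1 = η^{αβ} δ'(x - y)`. -/
def bracketDensity {n : ℕ} [NeZero n] {U : Opens (Fin n → ℂ)} (M : FrobeniusManifold n U)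
    (f g : DiffPoly U) : DiffPoly U :=
  ∑ α, ∑ β, ofConst (M.η⁻¹ α β) * (varDeriv α f * totalDeriv (varDeriv β g))

/-- `I = ∫ h dx` is a conservation law of the Principal Hierarchy: `{I, θ̄_{α,p}}_1 = 0` for all
`α` and all `p ≥ 0`. -/
def IsConservationLaw {n : ℕ} [NeZero n] {U : Opens (Fin n → ℂ)} {M : FrobeniusManifold n U}
    (L : LeveltSystem M) (h : DiffPoly U) : Prop :=
  ∀ (α : Fin n) (p : ℕ), IsZeroFunctional (bracketDensity M h (ofFun (L.θ α p)))

end PrincipalHierarchy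

end

/-!
Write `f` for the part of `h` that does not depend on the jets and `w` for the gradient of `∫ h dx`.
The bracket of `∫ h dx` with `∫ θ_{a,q+1} dx` has the density `⟨Q, ∇θ_{a,q}⟩` with `Q = v_x · w`, so
the variational derivatives of these densities vanish. Summed with powers of `z` over `q`, they are
the pairings of `∑_s (-∇)^s ∂Q/∂v^{μ,s} + z ∂_μ · Q` with the deformed flat covectors, where
`∇ = ∂_x + z v_x ·` is the deformed flat connection along `v_x`; hence this series is zero. As the
algebra has a unit, multiplication by `v_x` is injective on differential polynomials, and comparing
the top powers of `z` shows that `w` does not depend on the jets, that is, `δh/δv^α = ∂_α f`. So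
`h - f` has zero variational derivatives and is a total derivative plus a constant, by exactness
of the variational complex.

The coefficient of `z^0` gives the Hessian equation `∂_λ ∂_μ f = c^ν_{λμ} ∂_ν ∂_1 f`. Since `f` is
polynomial in `v^1`, induction on its degree shows that `f` is a combination of the `θ_{a,p}` plus a
constant: if `∂_1 f` is the combination `s` plus a constant, raising every index `p` of `s` by one
gives a combination with the same Hessian as `f`, and the difference is affine in the flat
coordinates.
-/

noncomputable section

namespace PrincipalHierarchy

open Matrix MvPolynomial
open scoped ContDiff
open Finset.HasAntidiagonal (antidiagonal)
open TopologicalSpace (Opens)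

/-! ### Closed one-forms on simply connected domains -/

section Gluing

variable {X G : Type*} [TopologicalSpace X] [AddCommGroup G] {V : X → Set X} {F : X → X → G}

/-- The bundle with discrete fibre `G` whose sections are the functions differing from each
`F x` by a locally constant function on `V x`: a section `v` corresponds to `v + F z z` at `z`. -/
@[reducible]
def differenceBundleCore [TopologicalSpace G] [ContinuousAdd G]
    (hV : ∀ x, IsOpen (V x)) (hmem : ∀ x, x ∈ V x)
    (hF : ∀ x y, ContinuousOn (F x - F y) (V x ∩ V y)) : FiberBundleCore X X G where
  baseSet := V
  isOpen_baseSet := hV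
  indexAt := id
  mem_baseSet_at := hmem
  coordChange x y z v := v + (F x - F y) z
  coordChange_self _ _ _ _ := by simp
  continuousOn_coordChange x y := continuousOn_snd.add <|
    (hF x y).comp continuousOn_fst fun _ hp => hp.1
  coordChange_comp _ _ _ _ _ _ := by simp only [Pi.sub_apply]; abel

theorem exists_continuousOn_sub_of_continuousOn_sub [SimplyConnectedSpace X]
    [LocallyPathConnectedSpace X] [TopologicalSpace G] [DiscreteTopology G]
    (hV : ∀ x, IsOpen (V x)) (hmem : ∀ x, x ∈ V x)
    (hF : ∀ x y, ContinuousOn (F x - F y) (V x ∩ V y)) :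
    ∃ f : X → G, ∀ x, ContinuousOn (f - F x) (V x) := by
  let Z := differenceBundleCore hV hmem hF
  have hcov : IsCoveringMap (Bundle.TotalSpace.proj : Bundle.TotalSpace G Z.Fiber → X) :=
    FiberBundle.isCoveringMap
  obtain ⟨x₀⟩ : Nonempty X := inferInstance
  obtain ⟨s, ⟨-, hs⟩, -⟩ := hcov.existsUnique_continuousMap_lifts (ContinuousMap.id X) x₀
    (⟨x₀, (0 : G)⟩ : Bundle.TotalSpace G Z.Fiber) rfl
  have hproj : ∀ x, (s x).proj = x := congrFun hs
  refine ⟨fun z => id (α := G) (s z).snd + F z z, fun x => ?_⟩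
  have hcont : ContinuousOn (fun z => (Z.localTriv x (s z)).2) (V x) := by
    refine continuousOn_snd.comp (t := Set.univ) ((Z.localTriv x).continuousOn.comp
      s.continuous.continuousOn fun z hz => ?_) fun _ _ => trivial
    rw [(Z.localTriv x).mem_source]
    change (s z).proj ∈ V x
    rw [hproj]
    exact hz
  refine hcont.congr fun z _ => ?_
  change _ = id (α := G) (s z).snd + (F (s z).proj (s z).proj - F x (s z).proj)
  rw [hproj, Pi.sub_apply, add_sub_assoc]

end Gluing

section Poincare

variable {𝕜 E F : Type*} [RCLike 𝕜] [NormedAddCommGroup E] [NormedSpace 𝕜 E]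
  [NormedAddCommGroup F] [NormedSpace 𝕜 F]

theorem eventually_sub_eq_of_hasFDerivAt {f g : E → F} {κ : E → E →L[𝕜] F} {s : Set E}
    (hs : IsOpen s) (hf : ∀ x ∈ s, HasFDerivAt f (κ x) x) (hg : ∀ x ∈ s, HasFDerivAt g (κ x) x)
    {x : E} (hx : x ∈ s) : ∀ᶠ y in nhds x, f y - g y = f x - g x := by
  obtain ⟨ε, hε, hball⟩ := Metric.isOpen_iff.1 hs x hx
  have hderiv : ∀ y ∈ Metric.ball x ε, HasFDerivAt (𝕜 := 𝕜) (fun p => f p - g p) 0 y :=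
    fun y hy => by simpa only [sub_self] using! (hf y (hball hy)).sub (hg y (hball hy))
  let _ : NormedSpace ℝ E := .restrictScalars ℝ 𝕜 E
  filter_upwards [Metric.ball_mem_nhds x hε] with y hy
  exact Metric.isOpen_ball.is_const_of_fderiv_eq_zero (𝕜 := 𝕜) (convex_ball x ε).isPreconnected
    (fun a ha => (hderiv a ha).differentiableAt.differentiableWithinAt)
    (fun a ha => (hderiv a ha).fderiv) hy (Metric.mem_ball_self hε)

theorem exists_hasFDerivAt_of_forall_exists_nhds {U : Set E} (hU : IsOpen U)
    [SimplyConnectedSpace U] {κ : E → E →L[𝕜] F}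
    (hκ : ∀ x ∈ U, ∃ f : E → F, ∀ᶠ y in nhds x, HasFDerivAt f (κ y) y) :
    ∃ f : E → F, ∀ x ∈ U, HasFDerivAt f (κ x) x := by
  let _ : NormedSpace ℝ E := .restrictScalars ℝ 𝕜 E
  have : LocallyPathConnectedSpace U := hU.locallyPathConnectedSpace
  choose f hf using fun x : U => hκ x x.2
  choose W hfW hW hmem using fun x : U => eventually_nhds_iff.1 (hf x)
  obtain ⟨g, hg⟩ : ∃ g : U → F, ∀ x : U, ∀ᶠ y in nhds x, g y - f x y = g x - f x x := by
    let _ : TopologicalSpace F := ⊥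
    have : DiscreteTopology F := ⟨rfl⟩
    obtain ⟨g, hg⟩ := exists_continuousOn_sub_of_continuousOn_sub (X := U) (G := F)
      (V := fun x => Subtype.val ⁻¹' W x) (F := fun x y => f x y)
      (fun x => (hW x).preimage continuous_subtype_val) hmem fun x y z hz => by
        refine (continuousAt_const (y := f x z - f y z)).congr ?_ |>.continuousWithinAt
        have := eventually_sub_eq_of_hasFDerivAt ((hW x).inter (hW y)) (fun a ha => hfW x a ha.1)
          (fun a ha => hfW y a ha.2) hz
        exact (continuous_subtype_val.tendsto z).eventually (this.mono fun _ h => h.symm)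
    exact ⟨g, fun x => ((hg x).continuousAt (((hW x).preimage continuous_subtype_val).mem_nhds
      (hmem x))).eventually (IsOpen.mem_nhds (isOpen_discrete {_}) rfl)⟩
  refine ⟨Function.extend Subtype.val g 0, fun x hx => ?_⟩
  refine (((hf ⟨x, hx⟩).self_of_nhds).add_const (g ⟨x, hx⟩ - f ⟨x, hx⟩ x)).congr_of_eventuallyEq ?_
  rw [Filter.EventuallyEq, ← map_nhds_subtype_coe_eq_nhds hx (hU.mem_nhds hx),
    Filter.eventually_map]
  filter_upwards [hg ⟨x, hx⟩] with y hy
  rw [Subtype.val_injective.extend_apply, ← hy, add_sub_cancel]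

theorem exists_hasFDerivAt_of_fderiv_symmetric [NormedSpace ℝ E] [NormedSpace ℝ F]
    [CompleteSpace F] {U : Set E} (hU : IsOpen U) [SimplyConnectedSpace U] {κ : E → E →L[𝕜] F}
    (hκ : DifferentiableOn ℝ κ U)
    (hsymm : ∀ x ∈ U, ∀ y z, fderiv ℝ κ x y z = fderiv ℝ κ x z y) :
    ∃ f : E → F, ∀ x ∈ U, HasFDerivAt f (κ x) x := by
  refine exists_hasFDerivAt_of_forall_exists_nhds hU fun x hx => ?_
  obtain ⟨ε, hε, hball⟩ := Metric.isOpen_iff.1 hU x hx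
  obtain ⟨f, hf⟩ := (convex_ball x ε).exists_forall_hasFDerivAt_of_fderiv_symmetric
    Metric.isOpen_ball (hκ.mono hball) fun a ha => hsymm a (hball ha)
  exact ⟨f, Filter.eventually_of_mem (Metric.ball_mem_nhds x hε) hf⟩

end Poincare

/-- The derivations `D i` of the `𝕜`-algebra `K` behave like the partial derivatives of the
functions on a simply connected domain: they commute, their common kernel consists of the
constants, and every closed one-form is exact. -/
structure IsPoincare {ι 𝕜 K : Type*} [CommRing 𝕜] [CommRing K] [Algebra 𝕜 K]
    (D : ι → Derivation 𝕜 K K) : Prop where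
  comm : ∀ i j a, D i (D j a) = D j (D i a)
  exists_eq_algebraMap : ∀ a, (∀ i, D i a = 0) → ∃ k, a = algebraMap 𝕜 K k
  exists_primitive : ∀ κ : ι → K, (∀ i j, D i (κ j) = D j (κ i)) → ∃ a, ∀ i, D i a = κ i

section Hol

variable {n : ℕ} {U : Opens (Fin n → ℂ)}

theorem differentiableAt_extend (f : Hol U) {x : Fin n → ℂ} (hx : x ∈ U) :
    DifferentiableAt ℂ (Function.extend Subtype.val f.1 0) x :=
  (f.2.contDiffAt (U.isOpen.mem_nhds hx)).differentiableAt (by simp)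

theorem fderiv_extend_eq_of_eqOn {f : U → ℂ} {g : (Fin n → ℂ) → ℂ} (hfg : ∀ x : U, f x = g x)
    (x : U) : fderiv ℂ (Function.extend Subtype.val f 0) x = fderiv ℂ g x := by
  refine Filter.EventuallyEq.fderiv_eq ?_
  filter_upwards [U.isOpen.mem_nhds x.2] with y hy
  rw [extend_coe f hy, hfg]

theorem pd_val (α : Fin n) (f : Hol U) (x : U) :
    (pd α f).1 x = fderiv ℂ (Function.extend Subtype.val f.1 0) x (Pi.single α 1) := rfl

theorem pd_add (α : Fin n) (f g : Hol U) : pd α (f + g) = pd α f + pd α g := by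
  refine Subtype.ext (funext fun x => ?_)
  rw [pd_val, fderiv_extend_eq_of_eqOn
    (g := Function.extend Subtype.val f.1 0 + Function.extend Subtype.val g.1 0)
    (fun y => by simp), fderiv_add (differentiableAt_extend f x.2) (differentiableAt_extend g x.2)]
  rfl

theorem pd_algebraMap (α : Fin n) (k : ℂ) : pd α (algebraMap ℂ (Hol U) k) = 0 := by
  refine Subtype.ext (funext fun x => ?_)
  rw [pd_val, fderiv_extend_eq_of_eqOn (f := (algebraMap ℂ (Hol U) k).1) (g := fun _ => k)
    fun _ => rfl]
  simp

theorem pd_mul (α : Fin n) (f g : Hol U) : pd α (f * g) = f * pd α g + g * pd α f := by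
  refine Subtype.ext (funext fun x => ?_)
  rw [pd_val, fderiv_extend_eq_of_eqOn
    (g := Function.extend Subtype.val f.1 0 * Function.extend Subtype.val g.1 0)
    (fun y => by simp), fderiv_mul (differentiableAt_extend f x.2) (differentiableAt_extend g x.2)]
  simp [pd_val]

/-- The partial derivative `∂/∂v^α` as a derivation of `𝒪(U)`. -/
def pdDer (α : Fin n) : Derivation ℂ (Hol U) (Hol U) :=
  Derivation.mk'
    { toFun := pd α
      map_add' := pd_add α
      map_smul' := fun k f => by
        simp only [Algebra.smul_def, pd_mul, pd_algebraMap, mul_zero, add_zero, RingHom.id_apply] }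
    fun f g => by simp [pd_mul]

@[simp] theorem pdDer_apply (α : Fin n) (f : Hol U) : pdDer α f = pd α f := rfl

theorem pd_coord (α β : Fin n) : pd α (coord β : Hol U) = if α = β then 1 else 0 := by
  refine Subtype.ext (funext fun x => ?_)
  rw [pd_val, fderiv_extend_eq_of_eqOn (f := (coord β : Hol U).1)
    (g := (ContinuousLinearMap.proj β : (Fin n → ℂ) →L[ℂ] ℂ)) fun _ => rfl,
    ContinuousLinearMap.fderiv, ContinuousLinearMap.proj_apply, Pi.single_apply]
  rcases eq_or_ne α β with rfl | hne
  · simp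
  · simp [hne, hne.symm]

theorem pd_pd_val (α β : Fin n) (f : Hol U) (x : U) :
    (pd α (pd β f)).1 x = fderiv ℂ (fderiv ℂ (Function.extend Subtype.val f.1 0)) x
      (Pi.single α 1) (Pi.single β 1) := by
  have hd : DifferentiableAt ℂ (fderiv ℂ (Function.extend Subtype.val f.1 0)) x :=
    ((f.2.contDiffAt (U.isOpen.mem_nhds x.2)).fderiv_right (m := 1) (by norm_cast)).differentiableAt
      (by simp)
  rw [pd_val, fderiv_extend_eq_of_eqOn (f := (pd β f).1)
    (g := fun y => fderiv ℂ (Function.extend Subtype.val f.1 0) y (Pi.single β 1)) (pd_val β f),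
    fderiv_clm_apply hd (by fun_prop)]
  simp

theorem pd_comm (α β : Fin n) (f : Hol U) : pd α (pd β f) = pd β (pd α f) := by
  refine Subtype.ext (funext fun x => ?_)
  rw [pd_pd_val, pd_pd_val]
  exact (f.2.contDiffAt (U.isOpen.mem_nhds x.2)).isSymmSndFDerivAt
    (by simp [ENat.LEInfty.out]) _ _

theorem apply_eq_sum_mul_apply_single (L : (Fin n → ℂ) →L[ℂ] ℂ) (y : Fin n → ℂ) :
    L y = ∑ α, y α * L (Pi.single α 1) := by
  conv_lhs => rw [← Finset.univ_sum_single y, map_sum]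
  refine Finset.sum_congr rfl fun α _ => ?_
  rw [← smul_eq_mul, ← map_smul, ← Pi.single_smul, smul_eq_mul, mul_one]

theorem fderiv_extend_apply (f : Hol U) (x : U) (y : Fin n → ℂ) :
    fderiv ℂ (Function.extend Subtype.val f.1 0) x y = ∑ α, y α * (pd α f).1 x :=
  apply_eq_sum_mul_apply_single _ y

theorem exists_eq_algebraMap_of_pd_eq_zero [PreconnectedSpace U] [Nonempty U] (f : Hol U)
    (hf : ∀ α, pd α f = 0) : ∃ k, f = algebraMap ℂ (Hol U) k := by
  obtain ⟨x₀⟩ : Nonempty U := inferInstance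
  have hpre : IsPreconnected (U : Set (Fin n → ℂ)) :=
    isPreconnected_iff_preconnectedSpace.2 inferInstance
  refine ⟨f.1 x₀, Subtype.ext (funext fun x => ?_)⟩
  have hconst := U.isOpen.is_const_of_fderiv_eq_zero (𝕜 := ℂ) hpre
    (fun y hy => (differentiableAt_extend f hy).differentiableWithinAt)
    (fun y hy => ContinuousLinearMap.ext fun z => by
      simpa [hf] using fderiv_extend_apply f ⟨y, hy⟩ z) x.2 x₀.2
  rwa [extend_coe _ x.2, extend_coe _ x₀.2] at hconst

/-- The one-form `∑ κ_α dv^α` on `U`, extended by zero. -/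
def oneForm (κ : Fin n → Hol U) (x : Fin n → ℂ) : (Fin n → ℂ) →L[ℂ] ℂ :=
  ∑ α, Function.extend Subtype.val (κ α).1 0 x • ContinuousLinearMap.proj α

theorem oneForm_apply (κ : Fin n → Hol U) (x z : Fin n → ℂ) :
    oneForm κ x z = ∑ α, Function.extend Subtype.val (κ α).1 0 x * z α := by
  simp [oneForm]

theorem contDiffOn_oneForm (κ : Fin n → Hol U) : ContDiffOn ℂ ∞ (oneForm κ) U := by
  simpa only [oneForm] using! ContDiffOn.sum fun α _ => (κ α).2.smul contDiffOn_const

theorem fderiv_oneForm_apply_single (κ : Fin n → Hol U) (x : U) (y : Fin n → ℂ) (β : Fin n) :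
    fderiv ℂ (oneForm κ) x y (Pi.single β 1) = ∑ α, y α * (pd α (κ β)).1 x := by
  have hd : DifferentiableAt ℂ (oneForm κ) x :=
    ((contDiffOn_oneForm κ).contDiffAt (U.isOpen.mem_nhds x.2)).differentiableAt (by simp)
  have happly : (fun p => oneForm κ p (Pi.single β 1)) = Function.extend Subtype.val (κ β).1 0 := by
    funext p
    simp [oneForm_apply, Pi.single_apply]
  rw [← fderiv_extend_apply, ← happly, fderiv_clm_apply hd (by fun_prop)]
  simp

theorem fderiv_oneForm_apply (κ : Fin n → Hol U) (x : U) (y z : Fin n → ℂ) :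
    fderiv ℂ (oneForm κ) x y z = ∑ β, ∑ α, y α * z β * (pd α (κ β)).1 x := by
  rw [apply_eq_sum_mul_apply_single]
  simp only [fderiv_oneForm_apply_single, Finset.mul_sum]
  exact Finset.sum_congr rfl fun β _ => Finset.sum_congr rfl fun α _ => by ring

theorem exists_pd_eq_of_closed [SimplyConnectedSpace U] (κ : Fin n → Hol U)
    (hκ : ∀ α β, pd α (κ β) = pd β (κ α)) : ∃ f : Hol U, ∀ α, pd α f = κ α := by
  have hdiff : ∀ x ∈ U, DifferentiableAt ℂ (oneForm κ) x := fun x hx =>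
    ((contDiffOn_oneForm κ).contDiffAt (U.isOpen.mem_nhds hx)).differentiableAt (by simp)
  obtain ⟨f, hf⟩ := exists_hasFDerivAt_of_fderiv_symmetric U.isOpen
    (fun x hx => ((hdiff x hx).restrictScalars ℝ).differentiableWithinAt) fun x hx y z => by
      rw [(hdiff x hx).fderiv_restrictScalars ℝ]
      change fderiv ℂ (oneForm κ) x y z = fderiv ℂ (oneForm κ) x z y
      rw [fderiv_oneForm_apply κ ⟨x, hx⟩, fderiv_oneForm_apply κ ⟨x, hx⟩, Finset.sum_comm]
      simp only [hκ, mul_comm]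
  have hfsmooth : ContDiffOn ℂ ∞ f U := (contDiffOn_infty_iff_fderiv_of_isOpen U.isOpen).2
    ⟨fun x hx => (hf x hx).differentiableAt.differentiableWithinAt,
      (contDiffOn_oneForm κ).congr fun x hx => (hf x hx).fderiv⟩
  refine ⟨⟨fun x => f x, IsHol.of_contDiffOn f hfsmooth fun _ => rfl⟩, fun α =>
    Subtype.ext (funext fun x => ?_)⟩
  rw [pd_val, fderiv_extend_eq_of_eqOn (g := f) fun _ => rfl, (hf x x.2).fderiv]
  simp [oneForm_apply, Pi.single_apply]

theorem isPoincare_pdDer [SimplyConnectedSpace U] :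
    IsPoincare (pdDer : Fin n → Derivation ℂ (Hol U) (Hol U)) where
  comm := pd_comm
  exists_eq_algebraMap := exists_eq_algebraMap_of_pd_eq_zero
  exists_primitive := exists_pd_eq_of_closed

end Hol

/-! ### Jet algebras -/

theorem derivation_sum_apply {ι R A B : Type*} [CommSemiring R] [CommSemiring A] [AddCommMonoid B]
    [Algebra R A] [Module A B] [Module R B] (S : Finset ι) (D : ι → Derivation R A B) (a : A) :
    (∑ i ∈ S, D i) a = ∑ i ∈ S, D i a := by
  simpa only [Finset.sum_apply] using! congrFun
    (map_sum (Derivation.coeFnAddMonoidHom (R := R) (A := A) (M := B)) D S) a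

section MvPolynomial

variable {σ R : Type*} [CommSemiring R]

theorem sum_mul_pderiv_eq_mkDerivation (φ : σ → MvPolynomial σ R) {S : Finset σ}
    {f : MvPolynomial σ R} (hf : f.vars ⊆ S) :
    ∑ j ∈ S, φ j * pderiv j f = mkDerivation R φ f := by
  classical
  suffices (∑ j ∈ S, φ j • pderiv j) f = mkDerivation R φ f by
    simpa only [derivation_sum_apply, Derivation.smul_apply, smul_eq_mul] using this
  refine derivation_eq_of_forall_mem_vars fun i hi => ?_
  simp only [mkDerivation_X, derivation_sum_apply, Derivation.smul_apply, smul_eq_mul, pderiv_X]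
  rw [Finset.sum_eq_single_of_mem i (hf hi) fun j _ hj => by simp [hj.symm]]
  simp

theorem coeff_X_mul_pderiv (j : σ) (f : MvPolynomial σ R) (m : σ →₀ ℕ) :
    coeff m (X j * pderiv j f) = m j • coeff m f := by
  classical
  induction f using MvPolynomial.induction_on' with
  | monomial l a =>
    rw [X_mul_pderiv_monomial, coeff_smul, coeff_monomial]
    split_ifs with hl
    · rw [hl]
    · rw [smul_zero, smul_zero]
  | add p q hp hq => rw [map_add, mul_add, coeff_add, coeff_add, hp, hq, smul_add]

theorem eq_C_of_pderiv_eq_zero [IsAddTorsionFree R] {f : MvPolynomial σ R}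
    (hf : ∀ j, pderiv j f = 0) : f = C (coeff 0 f) := by
  classical
  ext m
  rw [coeff_C]
  split_ifs with hm
  · rw [hm]
  · obtain ⟨j, hj⟩ := Finsupp.ne_iff.1 (Ne.symm hm)
    refine (nsmul_eq_zero_iff_right hj).1 ?_
    rw [← coeff_X_mul_pderiv, hf, mul_zero, coeff_zero]

theorem coeff_sum_smul_X_mul_pderiv (w : σ → ℕ) {S : Finset σ} {f : MvPolynomial σ R}
    (hS : f.vars ⊆ S) (m : σ →₀ ℕ) :
    coeff m (∑ j ∈ S, w j • (X j * pderiv j f)) = Finsupp.weight w m • coeff m f := by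
  simp only [coeff_sum, coeff_smul, coeff_X_mul_pderiv, smul_smul, ← Finset.sum_smul]
  by_cases hm : coeff m f = 0
  · rw [hm, smul_zero, smul_zero]
  · have hsupp : m.support ⊆ S := fun j hj =>
      hS ((mem_vars_iff_mem_support j).2 ⟨m, mem_support_iff.2 hm, hj⟩)
    rw [Finsupp.weight_apply, Finsupp.sum_of_support_subset m hsupp _ (by simp)]
    simp only [smul_eq_mul, mul_comm]

theorem weightedHomogeneousComponent_sum_smul_X_mul_pderiv (w : σ → ℕ) {S : Finset σ}
    {f : MvPolynomial σ R} (hS : f.vars ⊆ S) (k : ℕ) :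
    weightedHomogeneousComponent w k (∑ j ∈ S, w j • (X j * pderiv j f)) =
      k • weightedHomogeneousComponent w k f := by
  ext m
  rw [coeff_smul, coeff_weightedHomogeneousComponent, coeff_weightedHomogeneousComponent,
    coeff_sum_smul_X_mul_pderiv w hS]
  split_ifs with hk
  · rw [hk]
  · rw [smul_zero]

theorem sum_smul_X_mul_pderiv_of_isWeightedHomogeneous {w : σ → ℕ} {S : Finset σ}
    {f : MvPolynomial σ R} (hS : f.vars ⊆ S) {k : ℕ} (hf : IsWeightedHomogeneous w f k) :
    ∑ j ∈ S, w j • (X j * pderiv j f) = k • f := by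
  ext m
  rw [coeff_sum_smul_X_mul_pderiv w hS, coeff_smul]
  by_cases hm : coeff m f = 0
  · rw [hm, smul_zero, smul_zero]
  · rw [hf hm]

end MvPolynomial

section CoeffDer

variable {𝕜 K σ : Type*} [CommSemiring 𝕜] [CommSemiring K] [Algebra 𝕜 K]

theorem mvPolynomial_derivation_ext {D₁ D₂ : Derivation 𝕜 (MvPolynomial σ K) (MvPolynomial σ K)}
    (hC : ∀ a, D₁ (C a) = D₂ (C a)) (hX : ∀ j, D₁ (X j) = D₂ (X j)) : D₁ = D₂ := by
  refine Derivation.ext fun f => ?_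
  induction f using MvPolynomial.induction_on with
  | C a => exact hC a
  | add p q hp hq => rw [map_add, map_add, hp, hq]
  | mul_X p j hp => rw [D₁.leibniz, D₂.leibniz, hp, hX]

theorem coeff_sum_monomial_derivation (d : Derivation 𝕜 K K) (f : MvPolynomial σ K)
    (m : σ →₀ ℕ) : coeff m (∑ l ∈ f.support, monomial l (d (f.coeff l))) = d (f.coeff m) := by
  classical
  simp only [coeff_sum, coeff_monomial, Finset.sum_ite_eq', mem_support_iff]
  split_ifs with hm
  · rfl
  · rw [not_not.1 hm, map_zero]

/-- The extension of a derivation `d` of the coefficients to polynomials: `d` is applied to each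
coefficient, so that the variables are killed. -/
def coeffDer (d : Derivation 𝕜 K K) :
    Derivation 𝕜 (MvPolynomial σ K) (MvPolynomial σ K) where
  toFun f := ∑ m ∈ f.support, monomial m (d (f.coeff m))
  map_add' f g := by
    ext m
    rw [coeff_sum_monomial_derivation, coeff_add, coeff_add, coeff_sum_monomial_derivation,
      coeff_sum_monomial_derivation, map_add]
  map_smul' k f := by
    ext m
    rw [coeff_sum_monomial_derivation, RingHom.id_apply, coeff_smul, coeff_smul,
      coeff_sum_monomial_derivation, d.map_smul]
  map_one_eq_zero' := by
    classical
    ext m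
    simp only [LinearMap.coe_mk, AddHom.coe_mk]
    rw [coeff_sum_monomial_derivation, coeff_one, coeff_zero]
    split_ifs <;> simp
  leibniz' f g := by
    classical
    ext m
    simp only [LinearMap.coe_mk, AddHom.coe_mk, smul_eq_mul]
    rw [coeff_sum_monomial_derivation, mul_comm g, coeff_add, coeff_mul, coeff_mul, coeff_mul,
      map_sum, ← Finset.sum_add_distrib]
    refine Finset.sum_congr rfl fun x _ => ?_
    rw [d.leibniz, coeff_sum_monomial_derivation, coeff_sum_monomial_derivation, smul_eq_mul,
      smul_eq_mul, mul_comm (coeff x.2 g)]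

@[simp] theorem coeff_coeffDer (d : Derivation 𝕜 K K) (f : MvPolynomial σ K) (m : σ →₀ ℕ) :
    coeff m (coeffDer d f) = d (coeff m f) :=
  coeff_sum_monomial_derivation d f m

@[simp] theorem coeffDer_C (d : Derivation 𝕜 K K) (a : K) :
    coeffDer d (C a : MvPolynomial σ K) = C (d a) := by
  classical
  ext m
  rw [coeff_coeffDer, coeff_C, coeff_C, apply_ite d, map_zero]

@[simp] theorem coeffDer_X (d : Derivation 𝕜 K K) (j : σ) :
    coeffDer d (X j : MvPolynomial σ K) = 0 := by
  classical
  ext m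
  rw [coeff_coeffDer, coeff_X, apply_ite d, map_zero, Derivation.map_one_eq_zero, ite_self,
    coeff_zero]

end CoeffDer

/-- The algebra of differential polynomials with coefficients in a ring `K` of functions of the
coordinates `v^i`, `i ∈ ι`. As in `DiffPoly`, the variable `X (i, s)` stands for `v^{i,s+1}`. -/
abbrev JetAlgebra (ι K : Type*) [CommSemiring K] : Type _ := MvPolynomial (ι × ℕ) K

namespace JetAlgebra

variable {ι 𝕜 K : Type*} [CommRing 𝕜] [CommRing K] [Algebra 𝕜 K] (D : ι → Derivation 𝕜 K K)

/-- The derivation `∂/∂v^{α,s}`, where `v^{α,0} = v^α`. -/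
def jetDer (α : ι) : ℕ → Derivation 𝕜 (JetAlgebra ι K) (JetAlgebra ι K)
  | 0 => coeffDer (D α)
  | s + 1 => (pderiv (α, s)).restrictScalars 𝕜

theorem jetDer_zero (α : ι) : jetDer D α 0 = coeffDer (D α) := rfl

theorem jetDer_succ (α : ι) (s : ℕ) (f : JetAlgebra ι K) :
    jetDer D α (s + 1) f = pderiv (α, s) f := rfl

@[simp] theorem jetDer_zero_C (α : ι) (a : K) : jetDer D α 0 (C a) = C (D α a) :=
  coeffDer_C _ _

@[simp] theorem jetDer_succ_C (α : ι) (s : ℕ) (a : K) : jetDer D α (s + 1) (C a) = 0 :=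
  pderiv_C

@[simp] theorem jetDer_zero_X (α : ι) (j : ι × ℕ) : jetDer D α 0 (X j) = 0 :=
  coeffDer_X _ _

theorem jetDer_succ_X [DecidableEq ι] (α : ι) (s : ℕ) (j : ι × ℕ) :
    jetDer D α (s + 1) (X j) = if j = (α, s) then 1 else 0 := by
  rw [jetDer_succ, pderiv_X, Pi.single_apply]

/-- The largest `s` such that `v^{α,s}` occurs in `f` for some `α`, or `0` if there is none. -/
def order (f : JetAlgebra ι K) : ℕ :=
  f.vars.sup fun j => j.2 + 1

theorem lt_order_of_mem_vars {f : JetAlgebra ι K} {j : ι × ℕ} (hj : j ∈ f.vars) : j.2 < order f :=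
  Finset.le_sup (f := fun j : ι × ℕ => j.2 + 1) hj

@[simp] theorem order_C (a : K) : order (C a : JetAlgebra ι K) = 0 := by
  simp [order]

theorem jetDer_eq_zero_of_order_lt (α : ι) {s : ℕ} {f : JetAlgebra ι K} (hs : order f < s) :
    jetDer D α s f = 0 := by
  cases s with
  | zero => exact absurd hs (Nat.not_lt_zero _)
  | succ s =>
    exact pderiv_eq_zero_of_notMem_vars fun hmem => (lt_order_of_mem_vars hmem).not_ge
      (Nat.lt_succ_iff.1 hs)

variable [Fintype ι]

/-- The total derivative `∂_x = ∑_{α, s ≥ 0} v^{α,s+1} ∂/∂v^{α,s}`. -/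
def total : Derivation 𝕜 (JetAlgebra ι K) (JetAlgebra ι K) :=
  ∑ α, (X (α, 0) : JetAlgebra ι K) • coeffDer (D α)
    + (mkDerivation K fun j : ι × ℕ => (X (j.1, j.2 + 1) : JetAlgebra ι K)).restrictScalars 𝕜

theorem total_apply (f : JetAlgebra ι K) {S : Finset (ι × ℕ)} (hS : f.vars ⊆ S) :
    total D f = ∑ α, X (α, 0) * jetDer D α 0 f
      + ∑ j ∈ S, X (j.1, j.2 + 1) * jetDer D j.1 (j.2 + 1) f := by
  rw [total, Derivation.add_apply, derivation_sum_apply]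
  exact congrArg₂ _ rfl (sum_mul_pderiv_eq_mkDerivation _ hS).symm

theorem total_eq_sum_range (f : JetAlgebra ι K) {N : ℕ} (hN : order f ≤ N) :
    total D f = ∑ α, ∑ s ∈ Finset.range (N + 1), X (α, s) * jetDer D α s f := by
  classical
  rw [total_apply D f (S := Finset.univ ×ˢ Finset.range N) fun j hj => Finset.mem_product.2
    ⟨Finset.mem_univ _, Finset.mem_range.2 ((lt_order_of_mem_vars hj).trans_le hN)⟩,
    Finset.sum_product, ← Finset.sum_add_distrib]
  refine Finset.sum_congr rfl fun α _ => ?_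
  rw [Finset.sum_range_succ', add_comm]

theorem total_C (a : K) : total D (C a) = ∑ α, X (α, 0) * C (D α a) := by
  rw [total_apply D (C a) (S := ∅) (by simp)]
  simp

@[simp] theorem total_X (j : ι × ℕ) : total D (X j) = X (j.1, j.2 + 1) := by
  rw [total, Derivation.add_apply, derivation_sum_apply]
  simp only [Derivation.smul_apply, coeffDer_X, smul_zero, Finset.sum_const_zero, zero_add]
  exact mkDerivation_X _ _ _

theorem iterate_total_X_zero (α : ι) (s : ℕ) :
    (total D)^[s] (X (α, 0)) = (X (α, s) : JetAlgebra ι K) := by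
  induction s with
  | zero => rfl
  | succ s ih => rw [Function.iterate_succ_apply', ih, total_X]

theorem jetDer_zero_total (hcomm : ∀ i j a, D i (D j a) = D j (D i a)) (α : ι)
    (f : JetAlgebra ι K) : jetDer D α 0 (total D f) = total D (jetDer D α 0 f) := by
  have hbracket : ⁅jetDer D α 0, total D⁆ = 0 := by
    refine mvPolynomial_derivation_ext (fun a => ?_) fun j => ?_
    · simp only [Derivation.commutator_apply, total_C, map_sum, Derivation.leibniz,
        jetDer_zero_C, jetDer_zero_X, mul_zero, add_zero, Derivation.zero_apply, smul_eq_mul,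
        hcomm α, sub_self]
    · simp [Derivation.commutator_apply]
  rw [← sub_eq_zero, ← Derivation.commutator_apply, hbracket, Derivation.zero_apply]

theorem jetDer_succ_total (α : ι) (s : ℕ) (f : JetAlgebra ι K) :
    jetDer D α (s + 1) (total D f) = total D (jetDer D α (s + 1) f) + jetDer D α s f := by
  classical
  have hbracket : ⁅jetDer D α (s + 1), total D⁆ = jetDer D α s := by
    refine mvPolynomial_derivation_ext (fun a => ?_) fun j => ?_
    · rw [Derivation.commutator_apply, total_C, map_sum]
      simp only [Derivation.leibniz, jetDer_succ_C, map_zero, sub_zero, jetDer_succ_X,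
        Prod.mk.injEq, smul_eq_mul]
      cases s <;> simp
    · have hdelta : total D (if j = (α, s) then 1 else 0) = 0 := by split_ifs <;> simp
      rw [Derivation.commutator_apply, total_X, jetDer_succ_X, jetDer_succ_X, hdelta, sub_zero]
      cases s with
      | zero => simp
      | succ s => simp [jetDer_succ_X, Prod.ext_iff]
  rw [← hbracket, Derivation.commutator_apply, add_sub_cancel]

theorem jetDer_eq_zero_of_total_eq_zero {f : JetAlgebra ι K} (hf : total D f = 0)
    (α : ι) (s : ℕ) : jetDer D α s f = 0 := by
  have hdescent : ∀ k s, order f < s + k → jetDer D α s f = 0 := by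
    intro k
    induction k with
    | zero => exact fun s hs => jetDer_eq_zero_of_order_lt D α hs
    | succ k ih =>
      intro s hs
      have hs1 := jetDer_succ_total D α s f
      rwa [hf, ih (s + 1) (by omega), map_zero, map_zero, zero_add, eq_comm] at hs1
  exact hdescent (order f + 1) s (by omega)

theorem exists_eq_algebraMap_of_total_eq_zero [IsAddTorsionFree K]
    (hconst : ∀ a, (∀ i, D i a = 0) → ∃ k, a = algebraMap 𝕜 K k)
    {f : JetAlgebra ι K} (hf : total D f = 0) : ∃ k, f = algebraMap 𝕜 (JetAlgebra ι K) k := by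
  have hjet := jetDer_eq_zero_of_total_eq_zero D hf
  have hfC : f = C (coeff 0 f) := eq_C_of_pderiv_eq_zero fun j => hjet j.1 (j.2 + 1)
  obtain ⟨k, hk⟩ := hconst (coeff 0 f) fun α => by
    rw [← coeff_coeffDer, ← jetDer_zero, hjet α 0, coeff_zero]
  exact ⟨k, by rw [hfC, hk]; rfl⟩

end JetAlgebra

/-! ### Integration by parts -/

section IntegrationByParts

variable {𝕜 R : Type*} [CommRing 𝕜] [CommRing R] [Algebra 𝕜 R] (d : Derivation 𝕜 R R)

theorem derivation_sum_antidiagonal_mul {a b : ℕ → R} (ha : ∀ i, d (a i) = a (i + 1))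
    (hb : ∀ j, d (b j) = -b (j + 1)) (s : ℕ) :
    d (∑ p ∈ antidiagonal s, a p.1 * b p.2) = a (s + 1) * b 0 - a 0 * b (s + 1) := by
  have hright := Finset.Nat.sum_antidiagonal_succ (n := s) (f := fun p => a p.1 * b p.2)
  rw [Finset.Nat.sum_antidiagonal_succ'] at hright
  simp only [map_sum, d.leibniz, ha, hb, smul_eq_mul, mul_neg, Finset.sum_add_distrib,
    Finset.sum_neg_distrib, mul_comm (b _)]
  linear_combination -hright

theorem derivation_neg_pow_apply (b : R) (j : ℕ) :
    d (((-d.toLinearMap) ^ j) b) = -((-d.toLinearMap) ^ (j + 1)) b := by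
  rw [pow_succ', Module.End.mul_apply, LinearMap.neg_apply, neg_neg]
  rfl

theorem iterate_mul_sub_mul_neg_pow_mem_range (a b : R) (s : ℕ) :
    d^[s] a * b - a * ((-d.toLinearMap) ^ s) b ∈ LinearMap.range d.toLinearMap := by
  cases s with
  | zero => simp
  | succ s =>
    exact ⟨_, derivation_sum_antidiagonal_mul d (a := fun i => d^[i] a)
      (b := fun j => ((-d.toLinearMap) ^ j) b) (fun i => (Function.iterate_succ_apply' _ i a).symm)
      (derivation_neg_pow_apply d b) s⟩

end IntegrationByParts

namespace JetAlgebra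

/-! ### The variational derivative -/

variable {ι 𝕜 K : Type*} [Fintype ι] [CommRing 𝕜] [CommRing K] [Algebra 𝕜 K]
  (D : ι → Derivation 𝕜 K K)

theorem sum_range_neg_total_pow_jetDer (α : ι) {f : JetAlgebra ι K} {N : ℕ} (hN : order f ≤ N) :
    ∑ s ∈ Finset.range (order f + 1), ((-(total D).toLinearMap) ^ s) (jetDer D α s f) =
      ∑ s ∈ Finset.range (N + 1), ((-(total D).toLinearMap) ^ s) (jetDer D α s f) := by
  refine Finset.sum_subset (Finset.range_mono (by omega)) fun s _ hs => ?_
  rw [jetDer_eq_zero_of_order_lt D α (by simpa using hs), map_zero]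

theorem neg_total_pow_apply (s : ℕ) (f : JetAlgebra ι K) :
    ((-(total D).toLinearMap) ^ s) f = (-1) ^ s * (total D)^[s] f := by
  induction s with
  | zero => rw [pow_zero, pow_zero, one_mul]; rfl
  | succ s ih =>
    rw [pow_succ', Module.End.mul_apply, ih, Function.iterate_succ_apply', LinearMap.neg_apply,
      pow_succ]
    rcases neg_one_pow_eq_or (JetAlgebra ι K) s with hs | hs <;> simp [hs]

/-- The variational derivative `δ/δv^α = ∑ₛ (-∂_x)^s ∂/∂v^{α,s}`. -/
def varDer (α : ι) : JetAlgebra ι K →ₗ[𝕜] JetAlgebra ι K where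
  toFun f := ∑ s ∈ Finset.range (order f + 1), ((-(total D).toLinearMap) ^ s) (jetDer D α s f)
  map_add' f g := by
    let N := max (order (f + g)) (max (order f) (order g))
    rw [sum_range_neg_total_pow_jetDer D α (N := N) (by omega),
      sum_range_neg_total_pow_jetDer D α (N := N) (by omega),
      sum_range_neg_total_pow_jetDer D α (N := N) (by omega), ← Finset.sum_add_distrib]
    simp only [map_add]
  map_smul' k f := by
    let N := max (order (k • f)) (order f)
    rw [sum_range_neg_total_pow_jetDer D α (N := N) (by omega),
      sum_range_neg_total_pow_jetDer D α (N := N) (by omega), RingHom.id_apply, Finset.smul_sum]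
    simp only [Derivation.map_smul, map_smul]

theorem varDer_eq_sum_range (α : ι) {f : JetAlgebra ι K} {N : ℕ} (hN : order f ≤ N) :
    varDer D α f =
      ∑ s ∈ Finset.range (N + 1), ((-(total D).toLinearMap) ^ s) (jetDer D α s f) :=
  sum_range_neg_total_pow_jetDer D α hN

theorem varDer_C (α : ι) (a : K) : varDer D α (C a) = C (D α a) := by
  rw [varDer_eq_sum_range D α (N := 0) (order_C a).le]
  simp

theorem varDer_algebraMap (α : ι) (k : 𝕜) :
    varDer D α (algebraMap 𝕜 (JetAlgebra ι K) k) = 0 := by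
  rw [IsScalarTower.algebraMap_apply 𝕜 K, algebraMap_eq, varDer_C, Derivation.map_algebraMap,
    map_zero]

theorem varDer_total (hcomm : ∀ i j a, D i (D j a) = D j (D i a)) (α : ι) (g : JetAlgebra ι K) :
    varDer D α (total D g) = 0 := by
  have htelescope : ∀ M, ∑ s ∈ Finset.range (M + 1),
      ((-(total D).toLinearMap) ^ s) (jetDer D α s (total D g)) =
        ((-(total D).toLinearMap) ^ M) (total D (jetDer D α M g)) := by
    intro M
    induction M with
    | zero => simp [jetDer_zero_total D hcomm]
    | succ M ih =>
      rw [Finset.sum_range_succ, ih, jetDer_succ_total, map_add, pow_succ, Module.End.mul_apply,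
        Module.End.mul_apply, LinearMap.neg_apply, LinearMap.neg_apply, map_neg, map_neg]
      simp
  let N := max (order (total D g)) (order g + 1)
  rw [varDer_eq_sum_range D α (N := N) (by omega), htelescope,
    jetDer_eq_zero_of_order_lt D α (by omega), map_zero, map_zero]

/-- The densities of the local functionals that are zero: the total derivatives plus constants. -/
def nullDensity : Submodule 𝕜 (JetAlgebra ι K) :=
  LinearMap.range (total D).toLinearMap ⊔ LinearMap.range (Algebra.linearMap 𝕜 (JetAlgebra ι K))

theorem mem_nullDensity {f : JetAlgebra ι K} :
    f ∈ nullDensity D ↔ ∃ g k, f = total D g + algebraMap 𝕜 (JetAlgebra ι K) k := by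
  rw [nullDensity, Submodule.mem_sup]
  constructor
  · rintro ⟨_, ⟨g, rfl⟩, _, ⟨k, rfl⟩, rfl⟩
    exact ⟨g, k, rfl⟩
  · rintro ⟨g, k, rfl⟩
    exact ⟨_, ⟨g, rfl⟩, _, ⟨k, rfl⟩, rfl⟩

theorem total_mem_nullDensity (g : JetAlgebra ι K) : total D g ∈ nullDensity D :=
  (mem_nullDensity D).2 ⟨g, 0, by rw [map_zero, add_zero]⟩

theorem algebraMap_mem_nullDensity (k : 𝕜) :
    algebraMap 𝕜 (JetAlgebra ι K) k ∈ nullDensity D :=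
  (mem_nullDensity D).2 ⟨0, k, by rw [map_zero, zero_add]⟩

theorem varDer_eq_zero_of_mem_nullDensity (hcomm : ∀ i j a, D i (D j a) = D j (D i a))
    {f : JetAlgebra ι K} (hf : f ∈ nullDensity D) (α : ι) : varDer D α f = 0 := by
  obtain ⟨g, k, rfl⟩ := (mem_nullDensity D).1 hf
  rw [map_add, varDer_total D hcomm, varDer_algebraMap, add_zero]

/-! ### The grading by the number of derivatives -/

/-- The grading of differential polynomials in which `v^{α,s}` has degree `s`. -/
abbrev jetWeight (j : ι × ℕ) : ℕ := j.2 + 1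

theorem pderiv_eq_zero_of_isWeightedHomogeneous_of_lt {σ R : Type*} [CommSemiring R] {w : σ → ℕ}
    {f : MvPolynomial σ R} {k : ℕ} (hf : IsWeightedHomogeneous w f k) {j : σ} (hj : k < w j) :
    pderiv j f = 0 := by
  classical
  refine pderiv_eq_zero_of_notMem_vars fun hmem => ?_
  obtain ⟨m, hm, hjm⟩ := (mem_vars_iff_mem_support j).1 hmem
  have hle := Finsupp.le_weight_of_ne_zero' w (Finsupp.mem_support_iff.1 hjm)
  rw [hf (mem_support_iff.1 hm)] at hle
  omega

theorem isWeightedHomogeneous_coeffDer {σ : Type*} {w : σ → ℕ} (d : Derivation 𝕜 K K)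
    {f : MvPolynomial σ K} {k : ℕ} (hf : IsWeightedHomogeneous w f k) :
    IsWeightedHomogeneous w (coeffDer d f) k := fun m hm =>
  hf fun hzero => hm (by rw [coeff_coeffDer, hzero, map_zero])

theorem isWeightedHomogeneous_total {f : JetAlgebra ι K} {k : ℕ}
    (hf : IsWeightedHomogeneous jetWeight f k) :
    IsWeightedHomogeneous jetWeight (total D f) (k + 1) := by
  rw [total_apply D f subset_rfl, ← mem_weightedHomogeneousSubmodule]
  refine Submodule.add_mem _ (Submodule.sum_mem _ fun α _ => ?_) (Submodule.sum_mem _ fun j _ => ?_)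
  · rw [add_comm k]
    exact (isWeightedHomogeneous_X K jetWeight (α, 0)).mul (isWeightedHomogeneous_coeffDer (D α) hf)
  · rw [jetDer_succ]
    obtain hlt | hle := lt_or_ge k (jetWeight j)
    · rw [pderiv_eq_zero_of_isWeightedHomogeneous_of_lt hf hlt, mul_zero]
      exact Submodule.zero_mem _
    · have hdeg : jetWeight (j.1, j.2 + 1) + (k - jetWeight j) = k + 1 := by
        simp only [jetWeight] at hle ⊢
        omega
      rw [← hdeg]
      exact (isWeightedHomogeneous_X K jetWeight (j.1, j.2 + 1)).mul
        (hf.pderiv (Nat.sub_add_cancel hle))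

theorem weightedHomogeneousComponent_total_succ (f : JetAlgebra ι K) (k : ℕ) :
    weightedHomogeneousComponent jetWeight (k + 1) (total D f) =
      total D (weightedHomogeneousComponent jetWeight k f) := by
  induction f using MvPolynomial.induction_on' with
  | monomial m a =>
    have hm := isWeightedHomogeneous_monomial jetWeight m a rfl
    rw [weightedHomogeneousComponent_of_mem (isWeightedHomogeneous_total D hm),
      weightedHomogeneousComponent_of_mem hm, apply_ite (total D), map_zero]
    simp only [add_left_inj]
  | add p q hp hq => simp only [map_add, hp, hq]

theorem weightedHomogeneousComponent_zero_total (f : JetAlgebra ι K) :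
    weightedHomogeneousComponent jetWeight 0 (total D f) = 0 := by
  induction f using MvPolynomial.induction_on' with
  | monomial m a =>
    exact (isWeightedHomogeneous_total D
      (isWeightedHomogeneous_monomial jetWeight m a rfl)).weightedHomogeneousComponent_ne 0
        (Nat.succ_ne_zero _).symm
  | add p q hp hq => simp only [map_add, hp, hq, add_zero]

theorem weightedHomogeneousComponent_mem_nullDensity {f : JetAlgebra ι K}
    (hf : f ∈ nullDensity D) (k : ℕ) :
    weightedHomogeneousComponent jetWeight k f ∈ nullDensity D := by
  obtain ⟨g, c, rfl⟩ := (mem_nullDensity D).1 hf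
  rw [map_add]
  refine Submodule.add_mem _ ?_ ?_
  · cases k with
    | zero =>
      rw [weightedHomogeneousComponent_zero_total]
      exact Submodule.zero_mem _
    | succ k =>
      rw [weightedHomogeneousComponent_total_succ]
      exact total_mem_nullDensity D _
  · have hc : IsWeightedHomogeneous jetWeight (algebraMap 𝕜 (JetAlgebra ι K) c) 0 :=
      isWeightedHomogeneous_C _ _
    rw [weightedHomogeneousComponent_of_mem hc]
    split_ifs
    exacts [algebraMap_mem_nullDensity D c, Submodule.zero_mem _]

theorem eq_sum_X_mul_C_of_isWeightedHomogeneous_one [IsAddTorsionFree K] {f : JetAlgebra ι K}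
    (hf : IsWeightedHomogeneous jetWeight f 1) :
    f = ∑ α, X (α, 0) * C (coeff 0 (pderiv (α, 0) f)) := by
  classical
  have hfirst : ∀ α, pderiv (α, 0) f = C (coeff 0 (pderiv (α, 0) f)) := fun α =>
    eq_C_of_pderiv_eq_zero fun j => pderiv_eq_zero_of_isWeightedHomogeneous_of_lt
      (hf.pderiv (n' := 0) (by simp [jetWeight])) (Nat.succ_pos _)
  have hhigher : ∀ α s, pderiv (α, s + 1) f = 0 := fun α s =>
    pderiv_eq_zero_of_isWeightedHomogeneous_of_lt hf (by simp [jetWeight])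
  have heuler := sum_smul_X_mul_pderiv_of_isWeightedHomogeneous
    (S := Finset.univ ×ˢ Finset.range (order f + 1)) (fun j hj => Finset.mem_product.2
      ⟨Finset.mem_univ _, Finset.mem_range.2 (Nat.lt_succ_of_lt (lt_order_of_mem_vars hj))⟩) hf
  simp only [Finset.sum_product, Finset.sum_range_succ', hhigher, mul_zero, smul_zero,
    Finset.sum_const_zero, jetWeight, zero_add, one_smul, ← hfirst] at heuler ⊢
  exact heuler.symm

end JetAlgebra

/-! ### Exactness of the variational complex -/

theorem isAddTorsionFree_of_module (𝕜 E : Type*) [DivisionRing 𝕜] [CharZero 𝕜] [AddCommGroup E]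
    [Module 𝕜 E] : IsAddTorsionFree E :=
  have : Module ℚ E := Module.compHom E (algebraMap ℚ 𝕜)
  IsAddTorsionFree.of_module_rat E

namespace JetAlgebra

section NoetherDensity

variable {ι 𝕜 K : Type*} [Fintype ι] [CommRing 𝕜] [CommRing K] [Algebra 𝕜 K]
  (D : ι → Derivation 𝕜 K K)

/-- The density `∑ v^{α,i+1} (-∂_x)^j ∂g/∂v^{α,i+j+1}` which Noether's theorem attaches to the
invariance of the Lagrangian `g` under translations of `x`. -/
def noetherDensity (g : JetAlgebra ι K) : JetAlgebra ι K :=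
  ∑ α, ∑ s ∈ Finset.range (order g), ∑ p ∈ antidiagonal s,
    X (α, p.1) * ((-(total D).toLinearMap) ^ p.2) (pderiv (α, s) g)

theorem total_noetherDensity (g : JetAlgebra ι K) :
    total D (noetherDensity D g) = total D g - ∑ α, X (α, 0) * varDer D α g := by
  rw [noetherDensity, total_eq_sum_range D g le_rfl, map_sum, ← Finset.sum_sub_distrib]
  refine Finset.sum_congr rfl fun α _ => ?_
  rw [map_sum, varDer_eq_sum_range D α le_rfl, Finset.sum_range_succ',
    Finset.sum_range_succ' (fun s => ((-(total D).toLinearMap) ^ s) (jetDer D α s g)), mul_add,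
    pow_zero, Module.End.one_apply, add_sub_add_right_eq_sub, Finset.mul_sum,
    ← Finset.sum_sub_distrib]
  refine Finset.sum_congr rfl fun s _ => ?_
  exact derivation_sum_antidiagonal_mul (total D) (a := fun i => X (α, i))
    (b := fun j => ((-(total D).toLinearMap) ^ j) (pderiv (α, s) g))
    (fun i => total_X D (α, i)) (derivation_neg_pow_apply (total D) _) s

theorem sum_sub_noetherDensity_mem_nullDensity (g : JetAlgebra ι K) :
    ∑ j ∈ Finset.univ ×ˢ Finset.range (order g), jetWeight j • (X j * pderiv j g)
      - noetherDensity D g ∈ nullDensity D := by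
  rw [noetherDensity, Finset.sum_product, ← Finset.sum_sub_distrib]
  refine Submodule.sum_mem _ fun α _ => ?_
  rw [← Finset.sum_sub_distrib]
  refine Submodule.sum_mem _ fun s _ => ?_
  rw [jetWeight, ← Finset.Nat.card_antidiagonal s, ← Finset.sum_const, ← Finset.sum_sub_distrib]
  refine Submodule.sum_mem _ fun p hp => Submodule.mem_sup_left ?_
  have hX : X (α, s) = (total D)^[p.2] (X (α, p.1) : JetAlgebra ι K) := by
    rw [← iterate_total_X_zero D α p.1, ← Function.iterate_add_apply, add_comm,
      Finset.HasAntidiagonal.mem_antidiagonal.1 hp, iterate_total_X_zero]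
  rw [hX]
  exact iterate_mul_sub_mul_neg_pow_mem_range (total D) _ _ _

theorem varDer_sum_X_mul_C (a : ι → K) (β : ι) :
    varDer D β (∑ α, X (α, 0) * C (a α)) = ∑ α, X (α, 0) * C (D β (a α) - D α (a β)) := by
  classical
  set f : JetAlgebra ι K := ∑ α, X (α, 0) * C (a α) with hf
  have hjet0 : jetDer D β 0 f = ∑ α, X (α, 0) * C (D β (a α)) := by
    simp [hf, Derivation.leibniz]
  have hjet1 : jetDer D β 1 f = C (a β) := by
    simp [hf, Derivation.leibniz, jetDer_succ_X]
  have hjet2 : ∀ s, jetDer D β (s + 2) f = 0 := by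
    simp [hf, Derivation.leibniz, jetDer_succ_X]
  rw [varDer_eq_sum_range D β (Nat.le_succ _), Finset.sum_range_succ', Finset.sum_range_succ',
    Finset.sum_eq_zero fun s _ => by rw [hjet2, map_zero], zero_add, hjet0, hjet1, pow_zero,
    Module.End.one_apply, pow_one, LinearMap.neg_apply]
  change -total D (C (a β)) + _ = _
  simp only [total_C, map_sub, mul_sub, Finset.sum_sub_distrib, neg_add_eq_sub]

theorem eq_zero_of_sum_X_mul_C_eq_zero {a : ι → K}
    (ha : ∑ α, (X (α, 0) : JetAlgebra ι K) * C (a α) = 0) (β : ι) : a β = 0 := by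
  classical
  simpa [mul_comm (X _), coeff_sum, coeff_C_mul, coeff_X, Finsupp.single_left_inj one_ne_zero]
    using congrArg (coeff (Finsupp.single (β, 0) 1)) ha

end NoetherDensity

section Exactness

variable {ι 𝕜 K : Type*} [Fintype ι] [CommRing 𝕜] [CommRing K] [Algebra 𝕜 K]
  {D : ι → Derivation 𝕜 K K}

theorem mem_nullDensity_of_isWeightedHomogeneous_one [IsAddTorsionFree K] (hD : IsPoincare D)
    {f : JetAlgebra ι K} (hf : IsWeightedHomogeneous jetWeight f 1)
    (hvar : ∀ α, varDer D α f = 0) : f ∈ nullDensity D := by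
  rw [eq_sum_X_mul_C_of_isWeightedHomogeneous_one hf] at hvar ⊢
  obtain ⟨b, hb⟩ := hD.exists_primitive (fun α => coeff 0 (pderiv (α, 0) f)) fun α β => by
    have hα := hvar α
    rw [varDer_sum_X_mul_C] at hα
    exact sub_eq_zero.1 (eq_zero_of_sum_X_mul_C_eq_zero hα β)
  simp only [← hb, ← total_C]
  exact total_mem_nullDensity D _

theorem sum_sub_self_mem_nullDensity [IsAddTorsionFree K] (hD : IsPoincare D)
    {g : JetAlgebra ι K} (hg : ∀ α, varDer D α g = 0) :
    ∑ j ∈ Finset.univ ×ˢ Finset.range (order g), jetWeight j • (X j * pderiv j g) - g ∈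
      nullDensity D := by
  obtain ⟨k, hk⟩ := exists_eq_algebraMap_of_total_eq_zero D hD.exists_eq_algebraMap
    (f := noetherDensity D g - g) (by simp [total_noetherDensity, hg])
  rw [← sub_add_sub_cancel _ (noetherDensity D g), hk]
  exact Submodule.add_mem _ (sum_sub_noetherDensity_mem_nullDensity D g)
    (algebraMap_mem_nullDensity D k)

end Exactness

section Field

variable {ι 𝕜 K : Type*} [Fintype ι] [Field 𝕜] [CharZero 𝕜] [CommRing K] [Algebra 𝕜 K]
  {D : ι → Derivation 𝕜 K K}

theorem weightedHomogeneousComponent_mem_nullDensity_of_varDer_eq_zero [IsAddTorsionFree K]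
    (hD : IsPoincare D) {g : JetAlgebra ι K} (hg : ∀ α, varDer D α g = 0) {k : ℕ} (hk : k ≠ 1) :
    weightedHomogeneousComponent jetWeight k g ∈ nullDensity D := by
  have hvars : g.vars ⊆ Finset.univ ×ˢ Finset.range (order g) := fun j hj =>
    Finset.mem_product.2 ⟨Finset.mem_univ _, Finset.mem_range.2 (lt_order_of_mem_vars hj)⟩
  have hmem := weightedHomogeneousComponent_mem_nullDensity D (sum_sub_self_mem_nullDensity hD hg) k
  rw [map_sub, weightedHomogeneousComponent_sum_smul_X_mul_pderiv _ hvars,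
    ← Nat.cast_smul_eq_nsmul 𝕜, ← one_smul 𝕜 (weightedHomogeneousComponent _ _ g), smul_smul,
    mul_one, ← sub_smul] at hmem
  exact (Submodule.smul_mem_iff _ (sub_ne_zero.2 (Nat.cast_ne_one.2 hk))).1 hmem

theorem mem_nullDensity_of_varDer_eq_zero (hD : IsPoincare D) {g : JetAlgebra ι K}
    (hg : ∀ α, varDer D α g = 0) : g ∈ nullDensity D := by
  have : IsAddTorsionFree K := isAddTorsionFree_of_module 𝕜 K
  obtain ⟨S, hmem, hS⟩ : ∃ S : Finset ℕ, 1 ∈ S ∧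
      ∑ k ∈ S, weightedHomogeneousComponent jetWeight k g = g := by
    have hfinite : (Function.support fun k => weightedHomogeneousComponent jetWeight k g).Finite :=
      weightedHomogeneousComponent_finsupp g
    refine ⟨insert 1 hfinite.toFinset, Finset.mem_insert_self _ _, ?_⟩
    rw [← finsum_eq_sum_of_support_subset _ (by simp), sum_weightedHomogeneousComponent]
  rw [← Finset.add_sum_erase S _ hmem] at hS
  have hrest : ∑ k ∈ S.erase 1, weightedHomogeneousComponent jetWeight k g ∈ nullDensity D :=
    Submodule.sum_mem _ fun k hk =>
      weightedHomogeneousComponent_mem_nullDensity_of_varDer_eq_zero hD hg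
        (Finset.ne_of_mem_erase hk)
  have hone : weightedHomogeneousComponent jetWeight 1 g ∈ nullDensity D := by
    refine mem_nullDensity_of_isWeightedHomogeneous_one hD
      (weightedHomogeneousComponent_isWeightedHomogeneous 1 g) fun α => ?_
    rw [eq_sub_of_add_eq hS, map_sub, hg,
      varDer_eq_zero_of_mem_nullDensity D hD.comm hrest, sub_zero]
  have hsum := Submodule.add_mem _ hone hrest
  rwa [hS] at hsum

end Field

/-! ### Multiplication by the first jet -/

section FirstJet

variable {ι K : Type*} [CommRing K] (c : ι → ι → ι → K)

/-- The matrix of multiplication by `∂/∂v^δ` in the algebra with structure functions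
`c ν γ δ = c^ν_{γδ}`. -/
def mulMatrix (δ : ι) : Matrix ι ι (JetAlgebra ι K) :=
  Matrix.of fun ν γ => C (c ν γ δ)

variable [Fintype ι]

theorem mulMatrix_mulVec (y : ι → JetAlgebra ι K) (δ ν : ι) :
    (mulMatrix c δ *ᵥ y) ν = ∑ γ, C (c ν γ δ) * y γ := rfl

/-- The matrix of multiplication by `v_x = v^{δ,1} ∂/∂v^δ`. -/
def firstJetMatrix : Matrix ι ι (JetAlgebra ι K) :=
  ∑ δ, (X (δ, 0) : JetAlgebra ι K) • mulMatrix c δ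

theorem firstJetMatrix_mulVec (y : ι → JetAlgebra ι K) (ν : ι) :
    (firstJetMatrix c *ᵥ y) ν = ∑ δ, X (δ, 0) * ∑ γ, C (c ν γ δ) * y γ := by
  simp only [firstJetMatrix, sum_mulVec, smul_mulVec, Finset.sum_apply, Pi.smul_apply,
    mulMatrix_mulVec, smul_eq_mul]

variable {c}

theorem mulMatrix_mul_firstJetMatrix
    (hassoc : ∀ μ δ ν γ, ∑ ρ, c ν ρ μ * c ρ γ δ = ∑ ρ, c ν ρ δ * c ρ γ μ) (μ : ι) :
    mulMatrix c μ * firstJetMatrix c = firstJetMatrix c * mulMatrix c μ := by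
  rw [firstJetMatrix, Matrix.mul_sum, Matrix.sum_mul]
  refine Finset.sum_congr rfl fun δ _ => ?_
  rw [Matrix.mul_smul, Matrix.smul_mul]
  congr 1
  ext1 ν γ
  simp only [Matrix.mul_apply, mulMatrix, Matrix.of_apply, ← map_mul, ← map_sum, hassoc μ δ]

theorem coeff_eq_sub_of_firstJetMatrix_mulVec_eq_zero [DecidableEq ι] {o : ι}
    (hunit : ∀ ν γ, c ν γ o = if ν = γ then 1 else 0) {y : ι → JetAlgebra ι K}
    (hy : firstJetMatrix c *ᵥ y = 0) (ν : ι) (m : ι × ℕ →₀ ℕ) :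
    coeff m (y ν) = -∑ δ ∈ Finset.univ.erase o,
      coeff (m + Finsupp.single (o, 0) 1) (X (δ, 0) * ∑ γ, C (c ν γ δ) * y γ) := by
  have hcoeff := congrArg (coeff (m + Finsupp.single (o, 0) 1)) (congrFun hy ν)
  rw [firstJetMatrix_mulVec, coeff_sum, ← Finset.add_sum_erase _ _ (Finset.mem_univ o),
    add_comm m, coeff_X_mul] at hcoeff
  simp only [hunit, apply_ite C, map_one, map_zero, ite_mul, one_mul, zero_mul,
    Finset.sum_ite_eq, Finset.mem_univ, if_true, Pi.zero_apply, coeff_zero] at hcoeff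
  rw [add_comm m]
  exact eq_neg_of_add_eq_zero_left hcoeff

theorem eq_zero_of_firstJetMatrix_mulVec_eq_zero [DecidableEq ι] {o : ι}
    (hunit : ∀ ν γ, c ν γ o = if ν = γ then 1 else 0) {y : ι → JetAlgebra ι K}
    (hy : firstJetMatrix c *ᵥ y = 0) : y = 0 := by
  -- Since `∂/∂v^o` is the unit, the part of `v_x · y` of top degree in `v^{o,1}` is `v^{o,1}` times
  -- that of `y`; the induction descends on this degree.
  have hdescend : ∀ k d, (∑ ν, degreeOf (o, 0) (y ν)) < d + k →
      ∀ ν m, d ≤ m (o, 0) → coeff m (y ν) = 0 := by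
    intro k
    induction k with
    | zero =>
      intro d hd ν m hm
      by_contra hne
      have hdeg := monomial_le_degreeOf (o, 0) (mem_support_iff.2 hne)
      have hsum := Finset.single_le_sum (f := fun ν => degreeOf (o, 0) (y ν))
        (fun _ _ => Nat.zero_le _) (Finset.mem_univ ν)
      omega
    | succ k ih =>
      intro d hd ν m hm
      rw [coeff_eq_sub_of_firstJetMatrix_mulVec_eq_zero hunit hy, neg_eq_zero]
      refine Finset.sum_eq_zero fun δ hδ => ?_
      rw [coeff_X_mul']
      split_ifs
      · rw [coeff_sum]
        refine Finset.sum_eq_zero fun γ _ => ?_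
        have hne : ((δ, 0) : ι × ℕ) ≠ (o, 0) := fun h =>
          Finset.ne_of_mem_erase hδ (congrArg Prod.fst h)
        rw [coeff_C_mul, ih (d + 1) (by omega), mul_zero]
        simpa [hne] using hm
      · rfl
  funext ν
  ext1 m
  exact hdescend (∑ ν, degreeOf (o, 0) (y ν) + 1) 0 (by omega) ν m (Nat.zero_le _)

variable {𝕜 : Type*} [CommRing 𝕜] [Algebra 𝕜 K] (D : ι → Derivation 𝕜 K K)

theorem jetDer_one_firstJetMatrix_mulVec (w : ι → JetAlgebra ι K) (μ : ι) :
    (fun ν => jetDer D μ 1 ((firstJetMatrix c *ᵥ w) ν)) =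
      mulMatrix c μ *ᵥ w + firstJetMatrix c *ᵥ fun γ => jetDer D μ 1 (w γ) := by
  classical
  funext ν
  rw [Pi.add_apply, firstJetMatrix_mulVec, firstJetMatrix_mulVec, map_sum, mulMatrix_mulVec]
  simp only [Derivation.leibniz, jetDer_succ_X, map_sum, jetDer_succ_C, smul_eq_mul, mul_zero,
    add_zero, Finset.sum_add_distrib, Prod.mk.injEq, and_true, mul_ite, mul_one,
    Finset.sum_ite_eq', Finset.mem_univ, if_true]
  rw [add_comm]

theorem jetDer_add_two_firstJetMatrix_mulVec (w : ι → JetAlgebra ι K) (μ : ι) (s : ℕ) :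
    (fun ν => jetDer D μ (s + 2) ((firstJetMatrix c *ᵥ w) ν)) =
      firstJetMatrix c *ᵥ fun γ => jetDer D μ (s + 2) (w γ) := by
  classical
  funext ν
  rw [firstJetMatrix_mulVec, firstJetMatrix_mulVec, map_sum]
  refine Finset.sum_congr rfl fun δ _ => ?_
  simp [Derivation.leibniz, jetDer_succ_X]

end FirstJet

/-! ### The deformed flat connection along a curve -/

section Connection

variable {ι 𝕜 K : Type*} [Fintype ι] [CommRing 𝕜] [CommRing K] [Algebra 𝕜 K]
  (D : ι → Derivation 𝕜 K K) (c : ι → ι → ι → K)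

/-- The operator `∂_x + z v_x·` on series `∑ₖ S_k z^k` of vector fields along a curve: the
covariant derivative of the deformed flat connection along `v_x`. -/
def deformedConn : Module.End 𝕜 (ℕ → ι → JetAlgebra ι K) where
  toFun S
    | 0 => fun ν => total D (S 0 ν)
    | k + 1 => (fun ν => total D (S (k + 1) ν)) + firstJetMatrix c *ᵥ S k
  map_add' S T := by
    funext k ν
    cases k <;> simp [mulVec_add, add_add_add_comm]
  map_smul' a S := by
    funext k ν
    cases k <;> simp [mulVec_smul]

theorem deformedConn_zero_apply (S : ℕ → ι → JetAlgebra ι K) :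
    deformedConn D c S 0 = fun ν => total D (S 0 ν) := rfl

theorem deformedConn_succ_apply (S : ℕ → ι → JetAlgebra ι K) (k : ℕ) :
    deformedConn D c S (k + 1) =
      (fun ν => total D (S (k + 1) ν)) + firstJetMatrix c *ᵥ S k := rfl

variable {D c}

theorem deformedConn_succ_apply_of_eq_zero {S : ℕ → ι → JetAlgebra ι K} {k : ℕ}
    (hS : S (k + 1) = 0) : deformedConn D c S (k + 1) = firstJetMatrix c *ᵥ S k := by
  rw [deformedConn_succ_apply, hS, add_eq_right]
  exact funext fun _ => map_zero (total D)

/-- The operator `∑_{s < n} (-∇)^s y_s`, where `∇` is the deformed flat connection along `v_x`: it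
is the variational derivative of the pairing with deformed flat covectors. -/
def variationalSum (D : ι → Derivation 𝕜 K K) (c : ι → ι → ι → K) (n : ℕ)
    (y : ℕ → ι → JetAlgebra ι K) : ℕ → ι → JetAlgebra ι K :=
  ∑ s ∈ Finset.range n, ((-deformedConn D c) ^ s) (Pi.single 0 (y s))

theorem variationalSum_succ (n : ℕ) (y : ℕ → ι → JetAlgebra ι K) :
    variationalSum D c (n + 1) y =
      Pi.single 0 (y 0) - deformedConn D c (variationalSum D c n fun s => y (s + 1)) := by
  rw [variationalSum, Finset.sum_range_succ', variationalSum, map_sum, sub_eq_add_neg, add_comm,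
    ← Finset.sum_neg_distrib]
  simp only [pow_succ', Module.End.mul_apply, LinearMap.neg_apply, pow_zero,
    Module.End.one_apply]

theorem variationalSum_apply_eq_zero_of_le {n k : ℕ} (hk : n ≤ k) (y : ℕ → ι → JetAlgebra ι K) :
    variationalSum D c n y k = 0 := by
  induction n generalizing k y with
  | zero => simp [variationalSum]
  | succ n ih =>
    obtain ⟨k, rfl⟩ := Nat.exists_eq_succ_of_ne_zero (Nat.ne_zero_of_lt hk)
    rw [variationalSum_succ, Pi.sub_apply, Pi.single_eq_of_ne (Nat.succ_ne_zero k),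
      Nat.succ_eq_add_one, deformedConn_succ_apply_of_eq_zero (ih (by omega) _),
      ih (by omega), mulVec_zero, sub_zero]

variable [DecidableEq ι] {o : ι}

theorem eq_zero_of_deformedConn_apply_succ_eq_zero
    (hunit : ∀ ν γ, c ν γ o = if ν = γ then 1 else 0) {n d : ℕ} {y : ℕ → ι → JetAlgebra ι K}
    (hd : ∀ k, d ≤ k → deformedConn D c (variationalSum D c n y) (k + 1) = 0) {k : ℕ}
    (hk : d ≤ k) : variationalSum D c n y k = 0 := by
  obtain hn | hn := le_total n k
  · exact variationalSum_apply_eq_zero_of_le hn y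
  · induction hn using Nat.decreasingInduction with
    | self => exact variationalSum_apply_eq_zero_of_le le_rfl y
    | of_succ k _ ih =>
      have h := hd k hk
      rw [deformedConn_succ_apply_of_eq_zero (ih (by omega))] at h
      exact eq_zero_of_firstJetMatrix_mulVec_eq_zero hunit h

theorem eq_zero_of_variationalSum_eq_zero (hunit : ∀ ν γ, c ν γ o = if ν = γ then 1 else 0)
    {n : ℕ} {y : ℕ → ι → JetAlgebra ι K} (hy : variationalSum D c n y = 0) {s : ℕ} (hs : s < n) :
    y s = 0 := by
  induction n generalizing y s with
  | zero => omega
  | succ n ih =>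
    rw [variationalSum_succ, sub_eq_zero] at hy
    have htail : variationalSum D c n (fun s => y (s + 1)) = 0 := funext fun k =>
      eq_zero_of_deformedConn_apply_succ_eq_zero hunit
        (fun k _ => by rw [← hy, Pi.single_eq_of_ne (Nat.succ_ne_zero k)]) (Nat.zero_le k)
    cases s with
    | zero => rwa [htail, map_zero, Pi.single_eq_zero_iff] at hy
    | succ s => exact ih htail (by omega)

theorem eq_of_variationalSum_add_single_eq_zero
    (hunit : ∀ ν γ, c ν γ o = if ν = γ then 1 else 0) {n : ℕ} {y : ℕ → ι → JetAlgebra ι K}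
    {u : ι → JetAlgebra ι K} (hyu : variationalSum D c (n + 2) y + Pi.single 1 u = 0) :
    (∀ s < n, y (s + 2) = 0) ∧ (y 0 = fun ν => total D (y 1 ν)) ∧ u = firstJetMatrix c *ᵥ y 1 := by
  rw [variationalSum_succ, sub_add_eq_add_sub, sub_eq_zero] at hyu
  have htail : ∀ k, variationalSum D c (n + 1) (fun s => y (s + 1)) (k + 1) = 0 := fun k =>
    eq_zero_of_deformedConn_apply_succ_eq_zero hunit (d := 1) (fun k hk => by
      rw [← hyu, Pi.add_apply, Pi.single_eq_of_ne (by omega), Pi.single_eq_of_ne (by omega),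
        add_zero]) (by omega)
  have htail₂ : variationalSum D c n (fun s => y (s + 2)) = 0 := funext fun k =>
    eq_zero_of_deformedConn_apply_succ_eq_zero hunit (d := 0) (fun k _ => by
      have h := htail k
      rwa [variationalSum_succ, Pi.sub_apply, Pi.single_eq_of_ne (Nat.succ_ne_zero k), zero_sub,
        neg_eq_zero] at h) (Nat.zero_le k)
  rw [variationalSum_succ, htail₂, map_zero, sub_zero] at hyu
  refine ⟨fun s hs => eq_zero_of_variationalSum_eq_zero hunit htail₂ hs, ?_, ?_⟩
  · simpa [deformedConn_zero_apply] using congrFun hyu 0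
  · simpa [deformedConn_succ_apply_of_eq_zero] using congrFun hyu 1

end Connection

end JetAlgebra

/-! ### Pairing with deformed flat covectors -/

/-- The structure functions `c ν γ δ = c^ν_{γδ}` of a multiplication of vector fields, in
coordinates with derivations `D`, which is commutative and associative, has the unit `∂/∂v^o`, and
is constant along its unit. -/
structure IsFlatMultiplication {ι 𝕜 K : Type*} [Fintype ι] [DecidableEq ι] [CommRing 𝕜]
    [CommRing K] [Algebra 𝕜 K] (D : ι → Derivation 𝕜 K K) (c : ι → ι → ι → K) (o : ι) : Prop where
  symm : ∀ ν γ δ, c ν γ δ = c ν δ γ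
  assoc : ∀ μ δ ν γ, ∑ ρ, c ν ρ μ * c ρ γ δ = ∑ ρ, c ν ρ δ * c ρ γ μ
  unit : ∀ ν γ, c ν γ o = if ν = γ then 1 else 0
  deriv_unit : ∀ ν γ δ, D o (c ν γ δ) = 0

/-- The components `ξ a q ν` of covector fields `∑_q ξ_{a,q} z^q` that are flat for the deformed
connection, `∂_μ ξ_a = z C_μ^⊤ ξ_a`, and span all covectors at `z = 0`. -/
structure IsDeformedFlatFrame {ι J 𝕜 K : Type*} [Fintype ι] [CommRing 𝕜] [CommRing K]
    [Algebra 𝕜 K] (D : ι → Derivation 𝕜 K K) (c : ι → ι → ι → K) (ξ : J → ℕ → ι → K) : Prop where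
  deriv_zero : ∀ a μ ν, D μ (ξ a 0 ν) = 0
  deriv_succ : ∀ a q μ ν, D μ (ξ a (q + 1) ν) = ∑ ρ, c ρ ν μ * ξ a q ρ
  eq_zero_of_forall : ∀ y : ι → K, (∀ a, ∑ ν, y ν * ξ a 0 ν = 0) → y = 0

namespace JetAlgebra

section Pairing

variable {ι J K : Type*} [Fintype ι] [CommRing K] (ξ : J → ℕ → ι → K)

/-- The coefficient of `z^q` in the pairing of a series of vectors `∑ₖ S_k z^k` with the series of
covectors `∑ₗ ξ_{a,l} z^l`. -/
def pairing (a : J) (q : ℕ) : (ℕ → ι → JetAlgebra ι K) →+ JetAlgebra ι K where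
  toFun S := ∑ p ∈ antidiagonal q, ∑ ν, S p.1 ν * C (ξ a p.2 ν)
  map_zero' := by simp
  map_add' S T := by simp only [Pi.add_apply, add_mul, Finset.sum_add_distrib]

theorem pairing_apply (a : J) (q : ℕ) (S : ℕ → ι → JetAlgebra ι K) :
    pairing ξ a q S = ∑ p ∈ antidiagonal q, ∑ ν, S p.1 ν * C (ξ a p.2 ν) := rfl

theorem pairing_single_zero (a : J) (q : ℕ) (y : ι → JetAlgebra ι K) :
    pairing ξ a q (Pi.single 0 y) = ∑ ν, y ν * C (ξ a q ν) := by
  cases q with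
  | zero => simp [pairing_apply]
  | succ q => simp [pairing_apply, Finset.Nat.sum_antidiagonal_succ]

theorem pairing_single_one_zero (a : J) (y : ι → JetAlgebra ι K) :
    pairing ξ a 0 (Pi.single 1 y) = 0 := by
  simp [pairing_apply]

theorem pairing_single_one_succ (a : J) (q : ℕ) (y : ι → JetAlgebra ι K) :
    pairing ξ a (q + 1) (Pi.single 1 y) = ∑ ν, y ν * C (ξ a q ν) := by
  rw [← pairing_single_zero]
  simp [pairing_apply, Finset.Nat.sum_antidiagonal_succ, Pi.single_apply]

end Pairing

variable {ι J 𝕜 K : Type*} [Fintype ι] [CommRing 𝕜] [CommRing K] [Algebra 𝕜 K]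
  {D : ι → Derivation 𝕜 K K} {c : ι → ι → ι → K} {ξ : J → ℕ → ι → K}

theorem eq_zero_of_forall_pairing_eq_zero (hξ : IsDeformedFlatFrame D c ξ)
    {S : ℕ → ι → JetAlgebra ι K} (hS : ∀ a q, pairing ξ a q S = 0) : S = 0 := by
  funext k
  induction k using Nat.strong_induction_on with
  | _ k ih =>
    have hlead : ∀ a, ∑ ν, S k ν * C (ξ a 0 ν) = 0 := fun a => by
      rw [← hS a k, pairing_apply, Finset.sum_eq_single_of_mem (k, 0) (by simp)]
      intro p hp hne
      have hsum := Finset.HasAntidiagonal.mem_antidiagonal.1 hp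
      have hlt : p.1 < k := by
        refine lt_of_le_of_ne (by omega) fun h => hne (Prod.ext h ?_)
        simp only
        omega
      simp [ih p.1 hlt]
    funext ν
    ext1 m
    refine congrFun (hξ.eq_zero_of_forall (fun ν => coeff m (S k ν)) fun a => ?_) ν
    simpa [coeff_sum, mul_comm _ (C _), mul_comm _ (ξ _ _ _)] using congrArg (coeff m) (hlead a)

theorem sum_mul_total_C_succ (hξ : IsDeformedFlatFrame D c ξ) (a : J) (q : ℕ)
    (y : ι → JetAlgebra ι K) :
    ∑ ν, y ν * total D (C (ξ a (q + 1) ν)) = ∑ ν, (firstJetMatrix c *ᵥ y) ν * C (ξ a q ν) := by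
  simp only [total_C, hξ.deriv_succ, firstJetMatrix_mulVec, map_sum, map_mul, Finset.mul_sum,
    Finset.sum_mul]
  calc ∑ ν, ∑ δ, ∑ ρ, y ν * (X (δ, 0) * (C (c ρ ν δ) * C (ξ a q ρ)))
    _ = ∑ ν, ∑ ρ, ∑ δ, y ν * (X (δ, 0) * (C (c ρ ν δ) * C (ξ a q ρ))) :=
      Finset.sum_congr rfl fun ν _ => Finset.sum_comm
    _ = ∑ ρ, ∑ ν, ∑ δ, y ν * (X (δ, 0) * (C (c ρ ν δ) * C (ξ a q ρ))) := Finset.sum_comm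
    _ = ∑ ρ, ∑ δ, ∑ ν, y ν * (X (δ, 0) * (C (c ρ ν δ) * C (ξ a q ρ))) :=
      Finset.sum_congr rfl fun ρ _ => Finset.sum_comm
    _ = ∑ ρ, ∑ δ, ∑ ν, X (δ, 0) * (C (c ρ ν δ) * y ν) * C (ξ a q ρ) := by
      simp only [mul_comm, mul_left_comm]

theorem pairing_deformedConn (hξ : IsDeformedFlatFrame D c ξ) (a : J) (q : ℕ)
    (S : ℕ → ι → JetAlgebra ι K) :
    pairing ξ a q (deformedConn D c S) = total D (pairing ξ a q S) := by
  have htotal_zero : ∀ ν, total D (C (ξ a 0 ν)) = 0 := fun ν => by simp [total_C, hξ.deriv_zero]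
  have hleibniz : total D (pairing ξ a q S) =
      (∑ p ∈ antidiagonal q, ∑ ν, total D (S p.1 ν) * C (ξ a p.2 ν)) +
        ∑ p ∈ antidiagonal q, ∑ ν, S p.1 ν * total D (C (ξ a p.2 ν)) := by
    simp only [pairing_apply, map_sum, Derivation.leibniz, smul_eq_mul, ← Finset.sum_add_distrib,
      mul_comm (C _), add_comm]
  rw [hleibniz]
  cases q with
  | zero => simp [pairing_apply, deformedConn_zero_apply, htotal_zero]
  | succ q =>
    rw [Finset.Nat.sum_antidiagonal_succ' (f := fun p => ∑ ν, S p.1 ν * total D (C (ξ a p.2 ν)))]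
    simp only [htotal_zero, mul_zero, Finset.sum_const_zero, zero_add, sum_mul_total_C_succ hξ,
      pairing_apply, Finset.Nat.sum_antidiagonal_succ, deformedConn_zero_apply,
      deformedConn_succ_apply, Pi.add_apply, add_mul, Finset.sum_add_distrib, add_assoc]

theorem pairing_neg_deformedConn_pow (hξ : IsDeformedFlatFrame D c ξ) (a : J) (q s : ℕ)
    (S : ℕ → ι → JetAlgebra ι K) :
    pairing ξ a q (((-deformedConn D c) ^ s) S) =
      ((-(total D).toLinearMap) ^ s) (pairing ξ a q S) := by
  induction s with
  | zero => simp
  | succ s ih =>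
    rw [pow_succ', pow_succ', Module.End.mul_apply, Module.End.mul_apply, ← ih,
      LinearMap.neg_apply, LinearMap.neg_apply, map_neg, pairing_deformedConn hξ]
    rfl

/-! ### Densities with vanishing variational derivatives against all deformed flat covectors -/

theorem jetDer_zero_sum_mul_C (hξ : IsDeformedFlatFrame D c ξ) (Q : ι → JetAlgebra ι K) (μ : ι)
    (a : J) (q : ℕ) :
    jetDer D μ 0 (∑ ν, Q ν * C (ξ a q ν)) =
      ∑ ν, jetDer D μ 0 (Q ν) * C (ξ a q ν) +
        pairing ξ a q (Pi.single 1 (mulMatrix c μ *ᵥ Q)) := by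
  simp only [map_sum, Derivation.leibniz, smul_eq_mul, jetDer_zero_C, Finset.sum_add_distrib]
  rw [add_comm]
  refine congrArg₂ _ (Finset.sum_congr rfl fun ν _ => mul_comm _ _) ?_
  cases q with
  | zero => simp [hξ.deriv_zero, pairing_single_one_zero]
  | succ q =>
    rw [pairing_single_one_succ]
    simp only [hξ.deriv_succ, mulMatrix_mulVec, map_sum, map_mul, Finset.mul_sum, Finset.sum_mul]
    rw [Finset.sum_comm]
    simp only [mul_comm, mul_left_comm]

theorem jetDer_succ_sum_mul_C (Q : ι → JetAlgebra ι K) (μ : ι) (s : ℕ) (a : J) (q : ℕ) :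
    jetDer D μ (s + 1) (∑ ν, Q ν * C (ξ a q ν)) =
      ∑ ν, jetDer D μ (s + 1) (Q ν) * C (ξ a q ν) := by
  simp only [map_sum, Derivation.leibniz, jetDer_succ_C, smul_eq_mul, mul_zero, zero_add,
    mul_comm]

theorem varDer_sum_mul_C_eq_pairing (hξ : IsDeformedFlatFrame D c ξ) {Q : ι → JetAlgebra ι K}
    {μ : ι} {n : ℕ} (hn : ∀ s ν, n < s → jetDer D μ s (Q ν) = 0) (a : J) (q : ℕ) :
    varDer D μ (∑ ν, Q ν * C (ξ a q ν)) =
      pairing ξ a q (variationalSum D c (n + 1) (fun s ν => jetDer D μ s (Q ν)) +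
        Pi.single 1 (mulMatrix c μ *ᵥ Q)) := by
  set P := ∑ ν, Q ν * C (ξ a q ν) with hP
  have hPn : ∀ s, n < s → jetDer D μ s P = 0 := fun s hs => by
    obtain ⟨s, rfl⟩ := Nat.exists_eq_succ_of_ne_zero (Nat.ne_zero_of_lt hs)
    rw [hP, Nat.succ_eq_add_one, jetDer_succ_sum_mul_C]
    simp only [hn _ _ hs, zero_mul, Finset.sum_const_zero]
  rw [varDer_eq_sum_range D μ (le_max_left (order P) n), ← Finset.sum_subset
    (Finset.range_mono (Nat.succ_le_succ (le_max_right (order P) n))) fun s _ hs => by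
      rw [hPn s (by simpa using hs), map_zero], map_add, variationalSum, map_sum]
  simp only [pairing_neg_deformedConn_pow hξ, pairing_single_zero]
  rw [Finset.sum_range_succ', Finset.sum_range_succ', add_assoc]
  simp only [hP, jetDer_succ_sum_mul_C, jetDer_zero_sum_mul_C hξ, pow_zero, Module.End.one_apply]

variable [DecidableEq ι] {o : ι}

theorem jetDer_eq_of_varDer_sum_mul_C_eq_zero
    (hunit : ∀ ν γ, c ν γ o = if ν = γ then 1 else 0) (hξ : IsDeformedFlatFrame D c ξ)
    {Q : ι → JetAlgebra ι K} {μ : ι} (hQ : ∀ a q, varDer D μ (∑ ν, Q ν * C (ξ a q ν)) = 0) :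
    (∀ s ν, jetDer D μ (s + 2) (Q ν) = 0) ∧
      (∀ ν, jetDer D μ 0 (Q ν) = total D (jetDer D μ 1 (Q ν))) ∧
      mulMatrix c μ *ᵥ Q = firstJetMatrix c *ᵥ fun ν => jetDer D μ 1 (Q ν) := by
  -- `∑_s (-∇)^s ∂Q/∂v^{μ,s} + z ∂_μ · Q` pairs to zero with all deformed flat covectors, so it
  -- vanishes; its top coefficients in `z` then exclude jets of `Q` beyond the first.
  let n := ∑ ν, order (Q ν)
  have hn : ∀ s ν, n < s → jetDer D μ s (Q ν) = 0 := fun s ν hs =>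
    jetDer_eq_zero_of_order_lt D μ ((Finset.single_le_sum (f := fun ν => order (Q ν))
      (fun _ _ => Nat.zero_le _) (Finset.mem_univ ν)).trans_lt hs)
  obtain ⟨hhigh, hzero, hone⟩ := eq_of_variationalSum_add_single_eq_zero hunit (n := n)
    (eq_zero_of_forall_pairing_eq_zero hξ fun a q => by
      rw [← varDer_sum_mul_C_eq_pairing hξ (n := n + 1) fun s ν hs => hn s ν (by omega)]
      exact hQ a q)
  refine ⟨fun s ν => ?_, fun ν => congrFun hzero ν, hone⟩
  obtain hs | hs := lt_or_ge s n
  · exact congrFun (hhigh s hs) ν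
  · exact hn _ _ (by omega)

theorem eq_C_of_varDer_firstJetMatrix_mulVec_eq_zero [IsAddTorsionFree K]
    (hc : IsFlatMultiplication D c o) (hξ : IsDeformedFlatFrame D c ξ) {w : ι → JetAlgebra ι K}
    (hw : ∀ a q μ, varDer D μ (∑ ν, (firstJetMatrix c *ᵥ w) ν * C (ξ a q ν)) = 0) (γ : ι) :
    w γ = C (coeff 0 (w γ)) := by
  have hjet := fun μ => jetDer_eq_of_varDer_sum_mul_C_eq_zero hc.unit hξ fun a q => hw a q μ
  have hjet₁ : ∀ μ, (fun γ => jetDer D μ 1 (w γ)) = 0 := fun μ => by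
    have h := (hjet μ).2.2
    rw [jetDer_one_firstJetMatrix_mulVec, mulVec_add, mulVec_mulVec, mulVec_mulVec,
      mulMatrix_mul_firstJetMatrix hc.assoc, left_eq_add] at h
    exact eq_zero_of_firstJetMatrix_mulVec_eq_zero hc.unit
      (eq_zero_of_firstJetMatrix_mulVec_eq_zero hc.unit h)
  have hjet₂ : ∀ μ s, (fun γ => jetDer D μ (s + 2) (w γ)) = 0 := fun μ s =>
    eq_zero_of_firstJetMatrix_mulVec_eq_zero hc.unit <| by
      rw [← jetDer_add_two_firstJetMatrix_mulVec]
      exact funext ((hjet μ).1 s)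
  refine eq_C_of_pderiv_eq_zero fun j => ?_
  rw [← jetDer_succ D]
  obtain ⟨μ, _ | s⟩ := j
  exacts [congrFun (hjet₁ μ) γ, congrFun (hjet₂ μ s) γ]

theorem deriv_eq_sum_of_varDer_firstJetMatrix_mulVec_eq_zero
    (hc : IsFlatMultiplication D c o) (hξ : IsDeformedFlatFrame D c ξ) {f : ι → K}
    (hf : ∀ a q μ, varDer D μ (∑ ν, (firstJetMatrix c *ᵥ fun γ => C (f γ)) ν * C (ξ a q ν)) = 0)
    (μ ν : ι) : D μ (f ν) = ∑ γ, c ν γ μ * D o (f γ) := by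
  have hjet := (jetDer_eq_of_varDer_sum_mul_C_eq_zero hc.unit hξ fun a q => hf a q μ).2.1 ν
  rw [congrFun (jetDer_one_firstJetMatrix_mulVec D _ μ) ν] at hjet
  simp only [jetDer_succ_C, firstJetMatrix_mulVec, mulMatrix_mulVec, Pi.add_apply, mul_zero,
    Finset.sum_const_zero, add_zero, ← map_mul, ← map_sum, total_C] at hjet
  rw [map_sum, ← sub_eq_zero, ← Finset.sum_sub_distrib] at hjet
  simp only [Derivation.leibniz (jetDer D μ 0), jetDer_zero_C, jetDer_zero_X, smul_eq_mul, mul_zero,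
    add_zero, ← mul_sub, ← map_sub] at hjet
  have hcross := sub_eq_zero.1 (eq_zero_of_sum_X_mul_C_eq_zero hjet o)
  simpa [hc.unit, hc.deriv_unit, Derivation.leibniz] using hcross

end JetAlgebra

/-! ### Frobenius potentials and deformed flat coordinates -/

section Frobenius

theorem sum_smul_sum_smul_of_mul_eq_one {ι 𝕜 E : Type*} [Fintype ι] [DecidableEq ι] [CommRing 𝕜]
    [AddCommGroup E] [Module 𝕜 E] {A B : Matrix ι ι 𝕜} (hAB : A * B = 1) (y : ι → E) (α : ι) :
    ∑ β, A α β • ∑ γ, B β γ • y γ = y α := by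
  simp only [Finset.smul_sum, smul_smul]
  rw [Finset.sum_comm]
  simp only [← Finset.sum_smul, ← Matrix.mul_apply, hAB, Matrix.one_apply, ite_smul, one_smul,
    zero_smul, Finset.sum_ite_eq, Finset.mem_univ, if_true]

variable {ι 𝕜 K : Type*} [Fintype ι] [DecidableEq ι] [CommRing 𝕜] [CommRing K] [Algebra 𝕜 K]

/-- The potential `F` solves the associativity equations with respect to the constant metric `η`,
with unit `∂/∂v^o`; `D α` is the derivation along the flat coordinate `v^α`. -/
structure IsFrobeniusPotential (D : ι → Derivation 𝕜 K K) (o : ι) (η : Matrix ι ι 𝕜) (F : K) :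
    Prop where
  symm : η.IsSymm
  isUnit_det : IsUnit η.det
  unity : ∀ α β, D o (D α (D β F)) = algebraMap 𝕜 K (η α β)
  assoc : ∀ α β γ δ, ∑ l, ∑ m, η⁻¹ l m • (D α (D β (D l F)) * D m (D γ (D δ F))) =
    ∑ l, ∑ m, η⁻¹ l m • (D δ (D β (D l F)) * D m (D γ (D α F)))

/-- The structure functions `c^γ_{αβ} = η^{γε} ∂_ε ∂_α ∂_β F`. -/
def structureFun (D : ι → Derivation 𝕜 K K) (η : Matrix ι ι 𝕜) (F : K) (γ α β : ι) : K :=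
  ∑ ε, η⁻¹ γ ε • D ε (D α (D β F))

variable {D : ι → Derivation 𝕜 K K} {o : ι} {η : Matrix ι ι 𝕜} {F : K}

namespace IsFrobeniusPotential

theorem mul_inv (hF : IsFrobeniusPotential D o η F) : η * η⁻¹ = 1 :=
  Matrix.mul_nonsing_inv _ hF.isUnit_det

theorem inv_mul (hF : IsFrobeniusPotential D o η F) : η⁻¹ * η = 1 :=
  Matrix.nonsing_inv_mul _ hF.isUnit_det

theorem inv_symm (hF : IsFrobeniusPotential D o η F) (α β : ι) : η⁻¹ α β = η⁻¹ β α := by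
  have hsymm : (η⁻¹)ᵀ = η⁻¹ := by rw [Matrix.transpose_nonsing_inv, hF.symm]
  exact congrFun (congrFun hsymm β) α

theorem sum_smul_structureFun (hF : IsFrobeniusPotential D o η F) (α β γ : ι) :
    ∑ ν, η α ν • structureFun D η F ν β γ = D α (D β (D γ F)) :=
  sum_smul_sum_smul_of_mul_eq_one hF.mul_inv (fun ε => D ε (D β (D γ F))) α

theorem sum_structureFun_mul_structureFun (hcomm : ∀ i j a, D i (D j a) = D j (D i a))
    (η : Matrix ι ι 𝕜) (F : K) (μ δ ν γ : ι) :
    ∑ ρ, structureFun D η F ν ρ μ * structureFun D η F ρ γ δ =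
      ∑ ε, η⁻¹ ν ε • ∑ l, ∑ m, η⁻¹ l m • (D μ (D ε (D l F)) * D m (D γ (D δ F))) := by
  simp only [structureFun, Finset.sum_mul, Finset.smul_sum]
  rw [Finset.sum_comm]
  refine Finset.sum_congr rfl fun ε _ => Finset.sum_congr rfl fun l _ => ?_
  rw [Finset.mul_sum]
  refine Finset.sum_congr rfl fun m _ => ?_
  rw [hcomm μ ε, hcomm μ l, smul_mul_assoc, mul_smul_comm]

theorem isFlatMultiplication (hF : IsFrobeniusPotential D o η F)
    (hcomm : ∀ i j a, D i (D j a) = D j (D i a)) :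
    IsFlatMultiplication D (structureFun D η F) o where
  symm ν γ δ := by simp only [structureFun, hcomm γ δ]
  assoc μ δ ν γ := by
    simp only [sum_structureFun_mul_structureFun hcomm, hF.assoc μ]
  unit ν γ := by
    have hmetric : ∀ ε, D ε (D γ (D o F)) = algebraMap 𝕜 K (η ε γ) := fun ε => by
      rw [hcomm γ o, hcomm ε o, hF.unity]
    simp only [structureFun, hmetric, Algebra.smul_def, ← map_mul, ← map_sum, ← Matrix.mul_apply,
      hF.inv_mul, Matrix.one_apply, apply_ite (algebraMap 𝕜 K), map_one, map_zero]
  deriv_unit ν γ δ := by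
    rw [structureFun, map_sum]
    refine Finset.sum_eq_zero fun ε _ => ?_
    rw [Derivation.map_smul, hcomm o ε, hF.unity, Derivation.map_algebraMap, smul_zero]

end IsFrobeniusPotential

/-- The coefficients `θ a p` of deformed flat coordinates `θ_a(z) = ∑ₚ θ_{a,p} z^p` with
`θ_{a,0} = η_{aε} x^ε`, where `x` is the system of flat coordinates. -/
structure IsDeformedFlatCoordinates (D : ι → Derivation 𝕜 K K) (η : Matrix ι ι 𝕜) (F : K)
    (x : ι → K) (θ : ι → ℕ → K) : Prop where
  deriv_coord : ∀ α β, D α (x β) = if α = β then 1 else 0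
  zero : ∀ a, θ a 0 = ∑ ε, η a ε • x ε
  succ : ∀ a p l m, D l (D m (θ a (p + 1))) = ∑ ν, structureFun D η F ν l m * D ν (θ a p)

namespace IsDeformedFlatCoordinates

variable {x : ι → K} {θ : ι → ℕ → K}

theorem deriv_zero (hθ : IsDeformedFlatCoordinates D η F x θ) (a ν : ι) :
    D ν (θ a 0) = algebraMap 𝕜 K (η a ν) := by
  simp [hθ.zero, hθ.deriv_coord, Algebra.smul_def]

theorem isDeformedFlatFrame (hθ : IsDeformedFlatCoordinates D η F x θ)
    (hF : IsFrobeniusPotential D o η F) (hcomm : ∀ i j a, D i (D j a) = D j (D i a)) :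
    IsDeformedFlatFrame D (structureFun D η F) fun a q ν => D ν (θ a q) where
  deriv_zero a μ ν := by rw [hθ.deriv_zero, Derivation.map_algebraMap]
  deriv_succ a q μ ν := by simp only [hθ.succ, (hF.isFlatMultiplication hcomm).symm _ ν μ]
  eq_zero_of_forall y hy := funext fun ν => by
    rw [Pi.zero_apply, ← sum_smul_sum_smul_of_mul_eq_one hF.inv_mul y ν]
    refine Finset.sum_eq_zero fun a _ => ?_
    simp only [hθ.deriv_zero, mul_comm (y _), ← Algebra.smul_def] at hy
    rw [hy, smul_zero]

theorem coord_mem_span (hθ : IsDeformedFlatCoordinates D η F x θ)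
    (hF : IsFrobeniusPotential D o η F) (β : ι) :
    x β ∈ Submodule.span 𝕜 (Set.range fun i : ι × ℕ => θ i.1 i.2) := by
  rw [← sum_smul_sum_smul_of_mul_eq_one hF.inv_mul x β]
  refine Submodule.sum_mem _ fun a _ => Submodule.smul_mem _ _ ?_
  rw [← hθ.zero]
  exact Submodule.subset_span ⟨(a, 0), rfl⟩

theorem exists_mem_span_hessian_eq (hθ : IsDeformedFlatCoordinates D η F x θ) {s : K}
    (hs : s ∈ Submodule.span 𝕜 (Set.range fun i : ι × ℕ => θ i.1 i.2)) :
    ∃ t ∈ Submodule.span 𝕜 (Set.range fun i : ι × ℕ => θ i.1 i.2),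
      ∀ l m, D l (D m t) = ∑ ν, structureFun D η F ν l m * D ν s := by
  induction hs using Submodule.span_induction with
  | mem y hy =>
    obtain ⟨⟨a, p⟩, rfl⟩ := hy
    exact ⟨_, Submodule.subset_span ⟨(a, p + 1), rfl⟩, hθ.succ a p⟩
  | zero => exact ⟨0, zero_mem _, fun l m => by simp⟩
  | add y z _ _ hy hz =>
    obtain ⟨t, ht, hty⟩ := hy
    obtain ⟨u, hu, huz⟩ := hz
    exact ⟨t + u, add_mem ht hu, fun l m => by
      simp only [map_add, hty, huz, mul_add, Finset.sum_add_distrib]⟩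
  | smul r y _ hy =>
    obtain ⟨t, ht, hty⟩ := hy
    exact ⟨r • t, Submodule.smul_mem _ r ht, fun l m => by
      simp only [Derivation.map_smul, hty, Finset.smul_sum, mul_smul_comm]⟩

theorem exists_eq_sum_coord_of_hessian_eq_zero (hθ : IsDeformedFlatCoordinates D η F x θ)
    (hD : IsPoincare D) {a : K} (ha : ∀ l m, D l (D m a) = 0) :
    ∃ (b : ι → 𝕜) (k : 𝕜), a = ∑ β, b β • x β + algebraMap 𝕜 K k := by
  choose b hb using fun m => hD.exists_eq_algebraMap (D m a) fun l => ha l m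
  obtain ⟨k, hk⟩ := hD.exists_eq_algebraMap (a - ∑ β, b β • x β) fun α => by
    rw [map_sub, hb, map_sum]
    simp [hθ.deriv_coord, Algebra.smul_def]
  exact ⟨b, k, by rw [← hk, add_sub_cancel]⟩

theorem exists_mem_span_of_hessian_eq (hθ : IsDeformedFlatCoordinates D η F x θ)
    (hF : IsFrobeniusPotential D o η F) (hD : IsPoincare D) (N : ℕ) {f : K}
    (hf : ∀ l m, D l (D m f) = ∑ ν, structureFun D η F ν l m * D ν (D o f))
    (hN : (D o)^[N] f = 0) :
    ∃ s ∈ Submodule.span 𝕜 (Set.range fun i : ι × ℕ => θ i.1 i.2), ∃ k,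
      f = s + algebraMap 𝕜 K k := by
  induction N generalizing f with
  | zero => exact ⟨0, zero_mem _, 0, by simpa using hN⟩
  | succ N ih =>
    have hDof : ∀ l m, D l (D m (D o f)) = ∑ ν, structureFun D η F ν l m * D ν (D o (D o f)) := by
      intro l m
      rw [hD.comm m o, hD.comm l o, hf, map_sum]
      refine Finset.sum_congr rfl fun ν _ => ?_
      rw [Derivation.leibniz, (hF.isFlatMultiplication hD.comm).deriv_unit, smul_zero, add_zero,
        smul_eq_mul, hD.comm o ν]
    obtain ⟨s, hs, k, hfs⟩ := ih hDof hN
    obtain ⟨t, ht, hts⟩ := hθ.exists_mem_span_hessian_eq hs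
    obtain ⟨b, k', hft⟩ := hθ.exists_eq_sum_coord_of_hessian_eq_zero hD (a := f - t) fun l m => by
      rw [map_sub, map_sub, hf, hts, hfs]
      simp
    refine ⟨t + ∑ β, b β • x β, add_mem ht (Submodule.sum_mem _ fun β _ =>
      Submodule.smul_mem _ _ (hθ.coord_mem_span hF β)), k', ?_⟩
    rw [add_assoc, ← hft, add_sub_cancel]

end IsDeformedFlatCoordinates

end Frobenius

/-! ### Conservation laws -/

namespace JetAlgebra

section Coefficients

variable {ι 𝕜 K : Type*} [Fintype ι] [CommRing 𝕜] [CommRing K] [Algebra 𝕜 K]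
  (D : ι → Derivation 𝕜 K K)

theorem coeff_zero_total (f : JetAlgebra ι K) : coeff 0 (total D f) = 0 := by
  classical
  simp [total_apply D f subset_rfl, coeff_sum, coeff_X_mul']

theorem coeff_zero_varDer (α : ι) (f : JetAlgebra ι K) :
    coeff 0 (varDer D α f) = D α (coeff 0 f) := by
  rw [varDer_eq_sum_range D α le_rfl, Finset.sum_range_succ', coeff_add, coeff_sum,
    Finset.sum_eq_zero fun s _ => ?_]
  · simp [jetDer_zero]
  · rw [pow_succ', Module.End.mul_apply, LinearMap.neg_apply, coeff_neg]
    exact neg_eq_zero.2 (coeff_zero_total D _)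

/-- The density `(δf̄/δv^α) η^{αβ} ∂_x (δḡ/δv^β)` of the first Poisson bracket `{f̄, ḡ}_1`. -/
def bracket [DecidableEq ι] (η : Matrix ι ι 𝕜) (f g : JetAlgebra ι K) : JetAlgebra ι K :=
  ∑ α, ∑ β, η⁻¹ α β • (varDer D α f * total D (varDer D β g))

end Coefficients

variable {ι 𝕜 K : Type*} [Fintype ι] [DecidableEq ι] [CommRing 𝕜] [CommRing K] [Algebra 𝕜 K]
  {D : ι → Derivation 𝕜 K K} {o : ι} {η : Matrix ι ι 𝕜} {F : K} {x : ι → K} {θ : ι → ℕ → K}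
  {h : JetAlgebra ι K}

/-- The gradient `η^{αβ} δh̄/δv^β` of a local functional with respect to the metric. -/
def varGrad (D : ι → Derivation 𝕜 K K) (η : Matrix ι ι 𝕜) (h : JetAlgebra ι K) (α : ι) :
    JetAlgebra ι K :=
  ∑ β, η⁻¹ α β • varDer D β h

theorem coeff_zero_varGrad (h : JetAlgebra ι K) (α : ι) :
    coeff 0 (varGrad D η h α) = ∑ β, η⁻¹ α β • D β (coeff 0 h) := by
  simp only [varGrad, coeff_sum, coeff_smul, coeff_zero_varDer]

theorem bracket_C_succ (hF : IsFrobeniusPotential D o η F)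
    (hθ : IsDeformedFlatCoordinates D η F x θ) (hcomm : ∀ i j a, D i (D j a) = D j (D i a))
    (h : JetAlgebra ι K) (a : ι) (q : ℕ) :
    bracket D η h (C (θ a (q + 1))) =
      ∑ ν, (firstJetMatrix (structureFun D η F) *ᵥ varGrad D η h) ν * C (D ν (θ a q)) := by
  rw [← sum_mul_total_C_succ (hθ.isDeformedFlatFrame hF hcomm), bracket, Finset.sum_comm]
  refine Finset.sum_congr rfl fun β _ => ?_
  simp only [varGrad, Finset.sum_mul, smul_mul_assoc, varDer_C, hF.inv_symm β]

theorem varGrad_eq_C_of_bracket_mem_nullDensity [IsAddTorsionFree K]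
    (hF : IsFrobeniusPotential D o η F) (hθ : IsDeformedFlatCoordinates D η F x θ)
    (hcomm : ∀ i j a, D i (D j a) = D j (D i a))
    (hcons : ∀ a p, bracket D η h (C (θ a p)) ∈ nullDensity D) (γ : ι) :
    varGrad D η h γ = C (coeff 0 (varGrad D η h γ)) :=
  eq_C_of_varDer_firstJetMatrix_mulVec_eq_zero (hF.isFlatMultiplication hcomm)
    (hθ.isDeformedFlatFrame hF hcomm) (fun a q μ => by
      rw [← bracket_C_succ hF hθ hcomm]
      exact varDer_eq_zero_of_mem_nullDensity D hcomm (hcons a (q + 1)) μ) γ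

theorem varDer_eq_C_of_bracket_mem_nullDensity [IsAddTorsionFree K]
    (hF : IsFrobeniusPotential D o η F) (hθ : IsDeformedFlatCoordinates D η F x θ)
    (hcomm : ∀ i j a, D i (D j a) = D j (D i a))
    (hcons : ∀ a p, bracket D η h (C (θ a p)) ∈ nullDensity D) (α : ι) :
    varDer D α h = C (D α (coeff 0 h)) := by
  obtain ⟨a, ha⟩ : ∃ a, varDer D α h = C a := by
    refine ⟨∑ β, η α β • coeff 0 (varGrad D η h β), ?_⟩
    calc varDer D α h
      _ = ∑ β, η α β • varGrad D η h β :=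
        (sum_smul_sum_smul_of_mul_eq_one hF.mul_inv (fun β => varDer D β h) α).symm
      _ = ∑ β, η α β • C (coeff 0 (varGrad D η h β)) := Finset.sum_congr rfl fun β _ => by
        rw [← varGrad_eq_C_of_bracket_mem_nullDensity hF hθ hcomm hcons]
      _ = C (∑ β, η α β • coeff 0 (varGrad D η h β)) := by
        simp only [map_sum, C_apply, smul_monomial]
  rw [← coeff_zero_varDer, ha, coeff_zero_C]

theorem hessian_coeff_zero_of_bracket_mem_nullDensity [IsAddTorsionFree K]
    (hF : IsFrobeniusPotential D o η F) (hθ : IsDeformedFlatCoordinates D η F x θ)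
    (hcomm : ∀ i j a, D i (D j a) = D j (D i a))
    (hcons : ∀ a p, bracket D η h (C (θ a p)) ∈ nullDensity D) (l m : ι) :
    D l (D m (coeff 0 h)) =
      ∑ ν, structureFun D η F ν l m * D ν (D o (coeff 0 h)) := by
  set f := coeff 0 h with hf
  have hgrad : ∀ μ ν, D μ (coeff 0 (varGrad D η h ν)) =
      ∑ γ, structureFun D η F ν γ μ * D o (coeff 0 (varGrad D η h γ)) :=
    deriv_eq_sum_of_varDer_firstJetMatrix_mulVec_eq_zero (hF.isFlatMultiplication hcomm)
      (hθ.isDeformedFlatFrame hF hcomm) fun a q μ => by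
        simp only [← varGrad_eq_C_of_bracket_mem_nullDensity hF hθ hcomm hcons]
        rw [← bracket_C_succ hF hθ hcomm]
        exact varDer_eq_zero_of_mem_nullDensity D hcomm (hcons a (q + 1)) μ
  have hDo : ∀ γ, D o (∑ ν, η⁻¹ γ ν • D ν f) = ∑ ν, η⁻¹ γ ν • D ν (D o f) := fun γ => by
    rw [map_sum]
    exact Finset.sum_congr rfl fun ν _ => by rw [Derivation.map_smul, hcomm o ν]
  simp only [coeff_zero_varGrad, ← hf, hDo] at hgrad
  calc D l (D m f)
    _ = ∑ ν, η m ν • D l (∑ α, η⁻¹ ν α • D α f) := by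
      rw [← sum_smul_sum_smul_of_mul_eq_one hF.mul_inv (fun α => D α f) m, map_sum]
      simp only [Derivation.map_smul]
    _ = ∑ γ, (∑ ν, η m ν • structureFun D η F ν γ l) * ∑ ν, η⁻¹ γ ν • D ν (D o f) := by
      simp only [hgrad, Finset.smul_sum, Finset.sum_mul, smul_mul_assoc]
      rw [Finset.sum_comm]
    _ = ∑ γ, ∑ ν, η⁻¹ γ ν • (D m (D γ (D l F)) * D ν (D o f)) := by
      simp only [hF.sum_smul_structureFun, Finset.mul_sum, mul_smul_comm]
    _ = ∑ ν, structureFun D η F ν l m * D ν (D o f) := by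
      simp only [structureFun, Finset.sum_mul, smul_mul_assoc]
      rw [Finset.sum_comm]
      refine Finset.sum_congr rfl fun ν _ => Finset.sum_congr rfl fun γ _ => ?_
      rw [hF.inv_symm, hcomm m γ, hcomm m l]

end JetAlgebra

open JetAlgebra (bracket jetDer nullDensity total varDer)

/-! ### Holomorphic densities on a Frobenius manifold -/

theorem derivation_iterate_pow_mul_eq_zero {R A : Type*} [CommSemiring R] [CommSemiring A]
    [Algebra R A] (d : Derivation R A A) {x b : A} (hx : d x = 1) (hb : d b = 0) {m k : ℕ}
    (hk : k < m) : d^[m] (x ^ k * b) = 0 := by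
  induction m generalizing k b with
  | zero => omega
  | succ m ih =>
    have hpow : d (x ^ k * b) = x ^ (k - 1) * (k • b) := by
      rw [Derivation.leibniz, hb, smul_zero, zero_add, Derivation.leibniz_pow, hx]
      simp only [smul_eq_mul, nsmul_eq_mul]
      ring
    rw [Function.iterate_succ_apply, hpow]
    cases k with
    | zero => rw [zero_smul, mul_zero, Function.iterate_fixed (map_zero d)]
    | succ k => exact ih (by rw [map_nsmul, hb, smul_zero]) (by omega)

section DiffPoly

variable {n : ℕ} {U : Opens (Fin n → ℂ)}

theorem jetPd_eq_jetDer (α : Fin n) (s : ℕ) (f : DiffPoly U) :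
    jetPd α s f = jetDer pdDer α s f := by
  cases s <;> rfl

theorem totalDeriv_eq_total (f : DiffPoly U) : totalDeriv f = total pdDer f := by
  rw [JetAlgebra.total_apply _ f subset_rfl, totalDeriv]
  simp only [jetPd_eq_jetDer]

theorem varDeriv_eq_varDer (α : Fin n) (f : DiffPoly U) : varDeriv α f = varDer pdDer α f := by
  have htotal : totalDeriv = total (pdDer (U := U)) := funext totalDeriv_eq_total
  simp only [JetAlgebra.varDer_eq_sum_range pdDer α le_rfl, varDeriv, jetPd_eq_jetDer, htotal,
    JetAlgebra.neg_total_pow_apply]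
  rfl

theorem mem_nullDensity_of_isZeroFunctional {f : DiffPoly U} (hf : IsZeroFunctional f) :
    f ∈ nullDensity (pdDer (U := U)) := by
  obtain ⟨g, k, rfl⟩ := hf
  exact (JetAlgebra.mem_nullDensity pdDer).2 ⟨g, k, by rw [totalDeriv_eq_total]; rfl⟩

theorem exists_pdDer_iterate_coeff_zero_eq_zero [NeZero n] {h : DiffPoly U}
    (hpoly : IsPolynomialInFirst h) :
    ∃ N, (pdDer (0 : Fin n))^[N] (MvPolynomial.coeff 0 h) = 0 := by
  obtain ⟨N, a, ha, rfl⟩ := hpoly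
  refine ⟨N, ?_⟩
  rw [MvPolynomial.coeff_sum]
  refine Finset.sum_induction _ (fun f => (pdDer (0 : Fin n))^[N] f = 0)
    (fun f g hf hg => by rw [iterate_map_add, hf, hg, add_zero])
    (Function.iterate_fixed (map_zero _) N) fun k hk => ?_
  have hak : pdDer 0 (MvPolynomial.coeff 0 (a k)) = 0 := by
    rw [← coeff_coeffDer]
    exact congrArg (MvPolynomial.coeff 0) (ha k)
  rw [ofFun, ← map_pow, MvPolynomial.coeff_C_mul]
  exact derivation_iterate_pow_mul_eq_zero _ (by simp [pd_coord]) hak (Finset.mem_range.1 hk)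

variable [NeZero n]

theorem bracketDensity_eq_bracket (M : FrobeniusManifold n U) (f g : DiffPoly U) :
    bracketDensity M f g = bracket pdDer M.η f g := by
  simp only [bracketDensity, bracket, Algebra.smul_def, varDeriv_eq_varDer, totalDeriv_eq_total]
  rfl

theorem FrobeniusManifold.isFrobeniusPotential (M : FrobeniusManifold n U) :
    IsFrobeniusPotential pdDer 0 M.η M.F where
  symm := M.η_symm
  isUnit_det := M.η_nondeg
  unity := M.unity
  assoc := M.assoc

theorem LeveltSystem.isDeformedFlatCoordinates {M : FrobeniusManifold n U} (L : LeveltSystem M) :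
    IsDeformedFlatCoordinates pdDer M.η M.F coord L.θ where
  deriv_coord := pd_coord
  zero := L.θ_zero
  succ := L.θ_succ

theorem IsConservationLaw.bracket_mem_nullDensity {M : FrobeniusManifold n U} {L : LeveltSystem M}
    {h : DiffPoly U} (hcons : IsConservationLaw L h) (a : Fin n) (p : ℕ) :
    bracket pdDer M.η h (MvPolynomial.C (L.θ a p)) ∈ nullDensity (pdDer (U := U)) := by
  rw [← bracketDensity_eq_bracket]
  exact mem_nullDensity_of_isZeroFunctional (hcons a p)

end DiffPoly

end PrincipalHierarchy

end

theorem mainTheorem11_general {ι 𝕜 K : Type*} [Fintype ι] [DecidableEq ι] [Field 𝕜] [CharZero 𝕜]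
    [CommRing K] [Algebra 𝕜 K] {D : ι → Derivation 𝕜 K K} (hD : PrincipalHierarchy.IsPoincare D)
    {o : ι} {η : Matrix ι ι 𝕜} {F : K} (hF : PrincipalHierarchy.IsFrobeniusPotential D o η F)
    {x : ι → K} {θ : ι → ℕ → K} (hθ : PrincipalHierarchy.IsDeformedFlatCoordinates D η F x θ)
    {h : PrincipalHierarchy.JetAlgebra ι K}
    (hcons : ∀ a p, PrincipalHierarchy.JetAlgebra.bracket D η h (MvPolynomial.C (θ a p)) ∈
      PrincipalHierarchy.JetAlgebra.nullDensity D)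
    {N : ℕ} (hN : (D o)^[N] (MvPolynomial.coeff 0 h) = 0) :
    ∃ (c : ι × ℕ →₀ 𝕜) (g : PrincipalHierarchy.JetAlgebra ι K) (k : 𝕜),
      h = c.sum (fun i a => MvPolynomial.C (a • θ i.1 i.2))
        + PrincipalHierarchy.JetAlgebra.total D g + MvPolynomial.C (algebraMap 𝕜 K k) := by
  open PrincipalHierarchy PrincipalHierarchy.JetAlgebra MvPolynomial in
  have : IsAddTorsionFree K := isAddTorsionFree_of_module 𝕜 K
  obtain ⟨g, k₁, hg⟩ := (mem_nullDensity D).1 <|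
    mem_nullDensity_of_varDer_eq_zero hD (g := h - C (coeff 0 h)) fun α => by
      rw [map_sub, varDer_eq_C_of_bracket_mem_nullDensity hF hθ hD.comm hcons, varDer_C, sub_self]
  obtain ⟨s, hs, k₂, hk₂⟩ := hθ.exists_mem_span_of_hessian_eq hF hD N
    (hessian_coeff_zero_of_bracket_mem_nullDensity hF hθ hD.comm hcons) hN
  obtain ⟨c, rfl⟩ := Finsupp.mem_span_range_iff_exists_finsupp.1 hs
  refine ⟨c, g, k₁ + k₂, ?_⟩
  rw [sub_eq_iff_eq_add.1 hg, hk₂, map_add C, map_finsuppSum, map_add (algebraMap 𝕜 K), map_add C,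
    IsScalarTower.algebraMap_apply 𝕜 K, algebraMap_eq]
  abel

theorem mainTheorem11 (n : ℕ) [NeZero n] (U : TopologicalSpace.Opens (Fin n → ℂ))
    [SimplyConnectedSpace U] (M : PrincipalHierarchy.FrobeniusManifold n U)
    (hM : M.IsSemisimple) (L : PrincipalHierarchy.LeveltSystem M)
    (h : PrincipalHierarchy.DiffPoly U)
    (hcons : PrincipalHierarchy.IsConservationLaw L h)
    (hpoly : PrincipalHierarchy.IsPolynomialInFirst h) :
    ∃ (c : Fin n × ℕ →₀ ℂ) (g : PrincipalHierarchy.DiffPoly U) (k : ℂ),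
      h = c.sum (fun i a => PrincipalHierarchy.ofFun (a • L.θ i.1 i.2))
        + PrincipalHierarchy.totalDeriv g + PrincipalHierarchy.ofConst k := by
  obtain ⟨N, hN⟩ := PrincipalHierarchy.exists_pdDer_iterate_coeff_zero_eq_zero hpoly
  simp only [PrincipalHierarchy.totalDeriv_eq_total]
  exact mainTheorem11_general PrincipalHierarchy.isPoincare_pdDer M.isFrobeniusPotential
    L.isDeformedFlatCoordinates hcons.bracket_mem_nullDensity hN
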